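/- Let $s\in(0,1)$, let $N>2s$ be an integer, and let $\Omega\subset\mathbb R^N$ be a smooth bounded domain. Let $p,q>0$ satisfy $$1>\frac1{p+1}+\frac1{q+1}>\frac{N-2s}{N}.$$ Let $H\in C^1(\mathbb R^2,\mathbb R)$, $H=H(u,v)$, have strictly monotone gradient, i.e. $\langle\nabla H(z)-\nabla H(w),z-w\rangle>0$ for all $z\neq w$ in $\mathbb R^2$, and suppose that there are $C_1,C_2>0$ and $\alpha,\beta>1$ with $\frac{\alpha}{p+1}+\frac{\beta}{q+1}=1$ such that for all $(u,v)\in\mathbb R^2$ $$C_1|u|^{p+1}\le H_u(u,v)u\le C_2\big(|u|^{p+1}+|u|^\alpha|v|^\beta\big),\qquad C_1|v|^{q+1}\le H_v(u,v)v\le C_2\big(|v|^{q+1}+|u|^\alpha|v|^\beta\big).$$ *Weak solutions.* Let $X_0^s(\Omega)$ be the space of $u\in L^2(\mathbb R^N)$ with $u=0$ a.e. in $\mathbb R^N\setminus\Omega$ and $\iint\frac{|u(x)-u(y)|^2}{|x-y|^{N+2s}}dxdy<\infty$, and for $u,v\in X_0^s(\Omega)$ put $\langle(-\Delta)^su,v\rangle=\iint\frac{(u(x)-u(y))(v(x)-v(y))}{|x-y|^{N+2s}}dxdy$.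 Let $\mathcal T_s(\Omega)=\{\varphi\in X_0^s(\Omega):(-\Delta)^s\varphi\in C_c^\infty(\Omega)\}$ and $\delta(x)=\mathrm{dist}(x,\partial\Omega)$. For $f$ with $f\delta^s\in L^1(\Omega)$, an $L^1$-weak solution of $(-\Delta)^su=f$ in $\Omega$, $u=0$ in $\mathbb R^N\setminus\Omega$, is a $u\in L^1(\Omega)$ such that $\int_\Omega u(-\Delta)^s\varphi\,dx=\int_\Omega f\varphi\,dx$ for all $\varphi\in\mathcal T_s(\Omega)$. An $L^1$-weak solution of the fractional Hamiltonian system $$(-\Delta)^su=H_v(u,v),\quad(-\Delta)^sv=H_u(u,v)\ \text{ in }\Omega,\qquad u=v=0\ \text{ in }\mathbb R^N\setminus\Omega \tag{1}$$ is a pair $u,v\in L^1(\Omega)$ with $H_u(u,v)\delta^s,\,H_v(u,v)\delta^s\in L^1(\Omega)$ such that both equations hold in this sense. *Dual functional.* Let $X=L^{1+\frac1p}(\Omega)\times L^{1+\frac1q}(\Omega)$ and $X^*=L^{p+1}(\Omega)\times L^{q+1}(\Omega)$. For $f\in L^{1+\frac1p}(\Omega)$ let $\mathcal Af$ be the unique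 $L^1$-weak solution of $(-\Delta)^su=f$ in $\Omega$, $u=0$ in $\mathbb R^N\setminus\Omega$. Define $\mathcal J:X\to\mathbb R$ by $$\mathcal J(f,g)=\mathcal H^*(f,g)-\int_\Omega g\,\mathcal Af\,dx,\qquad \mathcal H^*(f,g)=\sup_{(u,v)\in X^*}\Big\{\int_\Omega(fu+gv)\,dx-\int_\Omega H(u,v)\,dx\Big\},$$ and let $H^*(x)=\sup_{w\in\mathbb R^2}\{\langle w,x\rangle-H(w)\}$ be the Legendre–Fenchel transform of $H$ on $\mathbb R^2$. **Proposition.** If $(f,g)\in X$ is a critical point of $\mathcal J$ (the Fréchet derivative of $\mathcal J$ at $(f,g)$ is zero), then $(u,v)=\nabla H^*(f,g)$ is an $L^1$-weak solution of (1). -/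

import Mathlib

open MeasureTheory
open scoped ENNReal ContDiff

noncomputable section

namespace FracHam

/-- `ℝ^N` with its Euclidean norm. -/
abbrev Eu (N : ℕ) : Type := EuclideanSpace ℝ (Fin N)

/-- A bounded smooth domain: nonempty, open, connected, bounded, and near each of its boundary
points the sublevel set of a smooth function with nonvanishing differential at that point. -/
structure IsSmoothBoundedDomain {N : ℕ} (Ω : Set (Eu N)) : Prop where
  isOpen : IsOpen Ω
  isConnected : IsConnected Ω
  isBounded : Bornology.IsBounded Ω
  smooth_boundary : ∀ x ∈ frontier Ω, ∃ U : Set (Eu N), IsOpen U ∧ x ∈ U ∧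
    ∃ ρ : Eu N → ℝ, ContDiff ℝ ∞ ρ ∧ fderiv ℝ ρ x ≠ 0 ∧ Ω ∩ U = {y ∈ U | ρ y < 0}

/-! ### The fractional Laplacian and weak solutions -/

/-- The integrand of the bilinear form,
`(u(x) - u(y)) (v(x) - v(y)) / |x - y|^(N + 2s)` at the pair `z = (x, y)`. -/
def gagliardoIntegrand {N : ℕ} (s : ℝ) (u v : Eu N → ℝ) (z : Eu N × Eu N) : ℝ :=
  (u z.1 - u z.2) * (v z.1 - v z.2) / ‖z.1 - z.2‖ ^ ((N : ℝ) + 2 * s)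

/-- Membership in `X_0^s(Ω)`. -/
structure MemX0 {N : ℕ} (s : ℝ) (Ω : Set (Eu N)) (u : Eu N → ℝ) : Prop where
  memLp : MemLp u 2 volume
  ae_zero : ∀ᵐ x ∂(volume : Measure (Eu N)), x ∉ Ω → u x = 0
  seminorm_finite : Integrable (gagliardoIntegrand s u u) (volume.prod volume)

/-- Membership in `C_c^∞(Ω)`. -/
structure IsTestFun {N : ℕ} (Ω : Set (Eu N)) (h : Eu N → ℝ) : Prop where
  smooth : ContDiff ℝ ∞ h
  compact_support : HasCompactSupport h
  support_subset : tsupport h ⊆ Ω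

/-- `φ` belongs to `𝒯_s(Ω)` and `(-Δ)^s φ` is the function `h ∈ C_c^∞(Ω)`: the functional
`(-Δ)^s φ` on `X_0^s(Ω)`, `v ↦ ∬ (φ(x) - φ(y)) (v(x) - v(y)) / |x - y|^(N + 2s)`,
is integration against `h`. -/
structure TestFracLap {N : ℕ} (s : ℝ) (Ω : Set (Eu N)) (φ h : Eu N → ℝ) : Prop where
  memX0 : MemX0 s Ω φ
  isTestFun : IsTestFun Ω h
  eq_dual : ∀ v : Eu N → ℝ, MemX0 s Ω v →
    ∫ z, gagliardoIntegrand s φ v z ∂(volume.prod volume) = ∫ x in Ω, h x * v x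

/-- The distance to the boundary. -/
def bdryDist {N : ℕ} (Ω : Set (Eu N)) (x : Eu N) : ℝ := Metric.infDist x (frontier Ω)

/-- `u` is an `L^1`-weak solution of `(-Δ)^s u = f` in `Ω`, `u = 0` in `ℝ^N ∖ Ω`:
`u ∈ L^1(Ω)`, `f ∈ L^1(Ω; δ^s dx)` and `∫_Ω u (-Δ)^s φ = ∫_Ω f φ` for all `φ ∈ 𝒯_s(Ω)`
(where the right-hand integral converges absolutely; the left-hand one does so because
`(-Δ)^s φ` is bounded). -/
structure IsL1WeakSol {N : ℕ} (s : ℝ) (Ω : Set (Eu N)) (f u : Eu N → ℝ) : Prop where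
  integrable_sol : IntegrableOn u Ω volume
  integrable_data : IntegrableOn (fun x => f x * bdryDist Ω x ^ s) Ω volume
  integrable_test : ∀ φ h : Eu N → ℝ, TestFracLap s Ω φ h →
    IntegrableOn (fun x => f x * φ x) Ω volume
  weak_eq : ∀ φ h : Eu N → ℝ, TestFracLap s Ω φ h →
    ∫ x in Ω, u x * h x = ∫ x in Ω, f x * φ x

/-! ### The Hamiltonian -/

/-- `∂F/∂u` at `z` for a function `F` of `(u, v) ∈ ℝ²`. -/
def partialU (F : ℝ × ℝ → ℝ) (z : ℝ × ℝ) : ℝ := fderiv ℝ F z (1, 0)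

/-- `∂F/∂v` at `z` for a function `F` of `(u, v) ∈ ℝ²`. -/
def partialV (F : ℝ × ℝ → ℝ) (z : ℝ × ℝ) : ℝ := fderiv ℝ F z (0, 1)

/-- `(u, v)` is an `L^1`-weak solution of the fractional Hamiltonian system
`(-Δ)^s u = H_v(u, v)`, `(-Δ)^s v = H_u(u, v)` in `Ω`, `u = v = 0` in `ℝ^N ∖ Ω`. -/
def IsL1WeakSolSystem {N : ℕ} (s : ℝ) (Ω : Set (Eu N)) (H : ℝ × ℝ → ℝ)
    (u v : Eu N → ℝ) : Prop :=
  IsL1WeakSol s Ω (fun x => partialV H (u x, v x)) u ∧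
  IsL1WeakSol s Ω (fun x => partialU H (u x, v x)) v

/-- The two-sided growth condition on the partial derivatives of `H`. -/
def GrowthCondition (p q : ℝ) (H : ℝ × ℝ → ℝ) : Prop :=
  ∃ C₁ C₂ α β : ℝ, 0 < C₁ ∧ 0 < C₂ ∧ 1 < α ∧ 1 < β ∧ α / (p + 1) + β / (q + 1) = 1 ∧
    ∀ u v : ℝ,
      C₁ * |u| ^ (p + 1) ≤ partialU H (u, v) * u ∧
      partialU H (u, v) * u ≤ C₂ * (|u| ^ (p + 1) + |u| ^ α * |v| ^ β) ∧
      C₁ * |v| ^ (q + 1) ≤ partialV H (u, v) * v ∧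
      partialV H (u, v) * v ≤ C₂ * (|v| ^ (q + 1) + |u| ^ α * |v| ^ β)

/-- `∇H` is strictly monotone. -/
def StrictMonoGradient (H : ℝ × ℝ → ℝ) : Prop :=
  ∀ z w : ℝ × ℝ, z ≠ w →
    0 < (partialU H z - partialU H w) * (z.1 - w.1) + (partialV H z - partialV H w) * (z.2 - w.2)

/-- The Legendre-Fenchel transform `H^*` on `ℝ²` (the supremum is finite when `H` grows
superlinearly, as it does under `GrowthCondition`). -/
def legendre (H : ℝ × ℝ → ℝ) (x : ℝ × ℝ) : ℝ :=
  ⨆ w : ℝ × ℝ, (w.1 * x.1 + w.2 * x.2 - H w)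

/-! ### The dual functional -/

instance factOneLe (t : ℝ) : Fact ((1 : ℝ≥0∞) ≤ 1 + ENNReal.ofReal t) := ⟨le_self_add⟩

/-- The space `L^(1+a)(Ω) × L^(1+b)(Ω)`, for `a, b > 0`. -/
abbrev PairSpace {N : ℕ} (Ω : Set (Eu N)) (a b : ℝ) : Type :=
  Lp ℝ (1 + ENNReal.ofReal a) ((volume : Measure (Eu N)).restrict Ω) ×
  Lp ℝ (1 + ENNReal.ofReal b) ((volume : Measure (Eu N)).restrict Ω)

/-- `X = L^(1+1/p)(Ω) × L^(1+1/q)(Ω)`. -/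
abbrev SpaceX {N : ℕ} (Ω : Set (Eu N)) (p q : ℝ) : Type := PairSpace Ω (1 / p) (1 / q)

/-- `X^* = L^(p+1)(Ω) × L^(q+1)(Ω)`. -/
abbrev SpaceXDual {N : ℕ} (Ω : Set (Eu N)) (p q : ℝ) : Type := PairSpace Ω p q

/-- `ℋ(u, v) = ∫_Ω H(u, v) dx` on `X^*`. -/
def hamFunctional {N : ℕ} (Ω : Set (Eu N)) (p q : ℝ) (H : ℝ × ℝ → ℝ)
    (w : SpaceXDual Ω p q) : ℝ :=
  ∫ x in Ω, H (w.1 x, w.2 x)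

/-- The Legendre-Fenchel transform `ℋ^*` of `ℋ`, on `X`. -/
def hamFunctionalStar {N : ℕ} (Ω : Set (Eu N)) (p q : ℝ) (H : ℝ × ℝ → ℝ)
    (z : SpaceX Ω p q) : ℝ :=
  ⨆ w : SpaceXDual Ω p q,
    ((∫ x in Ω, (z.1 x * w.1 x + z.2 x * w.2 x)) - hamFunctional Ω p q H w)

open Classical in
/-- The inverse `𝒜` of the fractional Laplacian: `𝒜 f` is the `L^1`-weak solution `u` of
`(-Δ)^s u = f` in `Ω`, `u = 0` in `ℝ^N ∖ Ω`. It exists for every `f ∈ L^r(Ω)`, `r ≥ 1`,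
and is unique almost everywhere in `Ω`; where there is no solution the value is `0`. -/
def invFracLap {N : ℕ} (s : ℝ) (Ω : Set (Eu N)) (f : Eu N → ℝ) : Eu N → ℝ :=
  if h : ∃ u : Eu N → ℝ, IsL1WeakSol s Ω f u then h.choose else 0

/-- The dual functional `𝒥(f, g) = ℋ^*(f, g) - ∫_Ω g 𝒜 f dx` on `X`. -/
def dualFunctional {N : ℕ} (s : ℝ) (Ω : Set (Eu N)) (p q : ℝ) (H : ℝ × ℝ → ℝ)
    (z : SpaceX Ω p q) : ℝ :=
  hamFunctionalStar Ω p q H z - ∫ x in Ω, z.2 x * invFracLap s Ω (z.1 : Eu N → ℝ) x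

/-- `z` is a critical point of `J`: the Fréchet derivative of `J` at `z` is zero. -/
def IsCriticalPoint {V : Type*} [NormedAddCommGroup V] [NormedSpace ℝ V] (J : V → ℝ)
    (z : V) : Prop :=
  HasFDerivAt J (0 : V →L[ℝ] ℝ) z

end FracHam

end

noncomputable section

namespace FracHam

section

/-! ### Energy solutions -/

/-- The weighted difference quotient whose square is `gagliardoIntegrand s u u`. -/
def gagliardoQuot {N : ℕ} (s : ℝ) (u : Eu N → ℝ) (z : Eu N × Eu N) : ℝ :=
  (u z.1 - u z.2) / ‖z.1 - z.2‖ ^ (((N : ℝ) + 2 * s) / 2)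

theorem gagliardoQuot_mul {N : ℕ} {s : ℝ} (hs : 0 < s) (u v : Eu N → ℝ) (z : Eu N × Eu N) :
    gagliardoQuot s u z * gagliardoQuot s v z = gagliardoIntegrand s u v z := by
  unfold gagliardoQuot gagliardoIntegrand
  rw [div_mul_div_comm, ← Real.rpow_add_of_nonneg (norm_nonneg _) (by positivity) (by positivity),
    add_halves]

theorem gagliardoIntegrand_comm {N : ℕ} (s : ℝ) (u v : Eu N → ℝ) :
    gagliardoIntegrand s u v = gagliardoIntegrand s v u := by
  ext z
  simp only [gagliardoIntegrand, mul_comm]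

theorem ae_comp_fst {N : ℕ} {P : Eu N → Prop} (h : ∀ᵐ x, P x) :
    ∀ᵐ z : Eu N × Eu N ∂(volume.prod volume), P z.1 :=
  Measure.quasiMeasurePreserving_fst.ae h

theorem ae_comp_snd {N : ℕ} {P : Eu N → Prop} (h : ∀ᵐ x, P x) :
    ∀ᵐ z : Eu N × Eu N ∂(volume.prod volume), P z.2 :=
  Measure.quasiMeasurePreserving_snd.ae h

theorem gagliardoQuot_congr {N : ℕ} (s : ℝ) {u v : Eu N → ℝ} (h : u =ᵐ[volume] v) :
    gagliardoQuot s u =ᵐ[volume.prod volume] gagliardoQuot s v := by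
  filter_upwards [ae_comp_fst h, ae_comp_snd h] with z h1 h2
  simp only [gagliardoQuot, h1, h2]

theorem aestronglyMeasurable_gagliardoQuot {N : ℕ} (s : ℝ) {u : Eu N → ℝ}
    (hu : AEStronglyMeasurable u volume) :
    AEStronglyMeasurable (gagliardoQuot s u) (volume.prod volume) := by
  have h : Measurable fun z : Eu N × Eu N => ‖z.1 - z.2‖ ^ (((N : ℝ) + 2 * s) / 2) := by
    fun_prop
  exact ((hu.comp_fst.aemeasurable.sub hu.comp_snd.aemeasurable).div
    h.aemeasurable).aestronglyMeasurable

variable {N : ℕ} {s : ℝ} {Ω : Set (Eu N)}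

theorem MemX0.memLp_gagliardoQuot {u : Eu N → ℝ} (hs : 0 < s) (hu : MemX0 s Ω u) :
    MemLp (gagliardoQuot s u) 2 (volume.prod volume) := by
  rw [memLp_two_iff_integrable_sq (aestronglyMeasurable_gagliardoQuot s hu.memLp.1)]
  refine hu.seminorm_finite.congr (Filter.Eventually.of_forall fun z => ?_)
  simp only [sq, gagliardoQuot_mul hs]

theorem MemX0.integrable_gagliardoIntegrand {u v : Eu N → ℝ} (hs : 0 < s) (hu : MemX0 s Ω u)
    (hv : MemX0 s Ω v) : Integrable (gagliardoIntegrand s u v) (volume.prod volume) := by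
  refine ((hu.memLp_gagliardoQuot hs).integrable_mul (hv.memLp_gagliardoQuot hs)).congr
    (Filter.Eventually.of_forall fun z => ?_)
  simp only [Pi.mul_apply, gagliardoQuot_mul hs]

theorem MemX0.of_gagliardoQuot_le {u k : Eu N → ℝ} (hs : 0 < s) (hu : MemX0 s Ω u)
    (hk : AEStronglyMeasurable k volume) (h0 : ∀ x, |k x| ≤ |u x|)
    (h1 : ∀ x y, |k x - k y| ≤ |u x - u y|) : MemX0 s Ω k where
  memLp := hu.memLp.mono hk (Filter.Eventually.of_forall h0)
  ae_zero := by
    filter_upwards [hu.ae_zero] with x hx hxΩ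
    have := h0 x
    rw [hx hxΩ, abs_zero] at this
    exact abs_nonpos_iff.1 this
  seminorm_finite := by
    have : MemLp (gagliardoQuot s k) 2 (volume.prod volume) := by
      refine (hu.memLp_gagliardoQuot hs).mono (aestronglyMeasurable_gagliardoQuot s hk)
        (Filter.Eventually.of_forall fun z => ?_)
      simp only [gagliardoQuot, norm_div, Real.norm_eq_abs]
      exact div_le_div_of_nonneg_right (h1 _ _) (abs_nonneg _)
    refine (this.integrable_mul this).congr (Filter.Eventually.of_forall fun z => ?_)
    simp only [Pi.mul_apply, gagliardoQuot_mul hs]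

theorem MemX0.neg {u : Eu N → ℝ} (hs : 0 < s) (hu : MemX0 s Ω u) : MemX0 s Ω (-u) :=
  hu.of_gagliardoQuot_le hs hu.memLp.1.neg (fun x => by simp)
    (fun x y => by simp only [Pi.neg_apply, neg_sub_neg, abs_sub_comm, le_refl])

/-- The nonlocal form controls integrals over `Ω`, by its interaction with a ball outside `Ω`. -/
theorem exists_coercivity_const (hs : 0 < s) (hN : 2 * s < (N : ℝ))
    (hb : Bornology.IsBounded Ω) (hm : MeasurableSet Ω) :
    ∃ c : ℝ, 0 < c ∧ ∀ u v w : Eu N → ℝ, MemX0 s Ω u → MemX0 s Ω v →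
      (∀ᵐ x, x ∈ Ω → w x ≤ u x * v x) →
      (∀ z, 0 ≤ gagliardoIntegrand s u v z) → IntegrableOn w Ω →
      (∀ x, 0 ≤ w x) →
      c * ∫ x in Ω, w x ≤ ∫ z, gagliardoIntegrand s u v z ∂(volume.prod volume) := by
  have hNpos : 0 < N := by
    have : (0 : ℝ) < N := by linarith
    exact_mod_cast this
  have : Nonempty (Fin N) := ⟨⟨0, hNpos⟩⟩
  obtain ⟨r, hr⟩ := hb.subset_closedBall (0 : Eu N)
  obtain ⟨e, he⟩ := NormedSpace.exists_lt_norm ℝ (Eu N) (r + 1)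
  set B := Metric.ball e 1 with hB
  set R := |r| + ‖e‖ + 1 with hR
  have hRpos : 0 < R := by positivity
  have hBpos : 0 < volume.real B :=
    ENNReal.toReal_pos (Metric.measure_ball_pos _ _ one_pos).ne' measure_ball_lt_top.ne
  set a := (N : ℝ) + 2 * s with ha
  have ha0 : 0 < a := by positivity
  have hBΩ : ∀ y ∈ B, y ∉ Ω := by
    intro y hy hyΩ
    have h1 : ‖y‖ ≤ r := by simpa using hr hyΩ
    have h2 : ‖y - e‖ < 1 := mem_ball_iff_norm.1 hy
    have h3 := norm_sub_norm_le e y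
    rw [norm_sub_rev] at h3
    linarith
  have hdist : ∀ x ∈ Ω, ∀ y ∈ B, 0 < ‖x - y‖ ∧ ‖x - y‖ ≤ R := by
    intro x hx y hy
    constructor
    · rw [norm_pos_iff, sub_ne_zero]
      rintro rfl
      exact hBΩ x hy hx
    · have h1 : ‖x‖ ≤ r := by simpa using hr hx
      have h2 : ‖y - e‖ < 1 := mem_ball_iff_norm.1 hy
      have h3 := norm_sub_le x y
      have h4 := norm_le_norm_add_norm_sub' y e
      have := le_abs_self r
      linarith
  refine ⟨(R ^ a)⁻¹ * volume.real B, by positivity, fun u v w hu hv hw h0 hwi hw0 => ?_⟩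
  have hprod : ((volume : Measure (Eu N)).prod (volume : Measure (Eu N))).restrict (Ω ×ˢ B) =
      (volume.restrict Ω).prod (volume.restrict B) := (Measure.prod_restrict _ _).symm
  have hmB : MeasurableSet (Ω ×ˢ B) := hm.prod measurableSet_ball
  have e1 : ∫ z in Ω ×ˢ B, w z.1 * (R ^ a)⁻¹ ∂(volume.prod volume) =
      (∫ x in Ω, w x) * (volume.real B * (R ^ a)⁻¹) := by
    rw [setIntegral_prod_mul w (fun _ => (R ^ a)⁻¹) Ω B, setIntegral_const, smul_eq_mul]
  have hint := hu.integrable_gagliardoIntegrand hs hv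
  have hcint : IntegrableOn (fun _ : Eu N => (R ^ a)⁻¹) B volume :=
    integrableOn_const measure_ball_lt_top.ne
  have e2 : ∫ z in Ω ×ˢ B, w z.1 * (R ^ a)⁻¹ ∂(volume.prod volume) ≤
      ∫ z in Ω ×ˢ B, gagliardoIntegrand s u v z ∂(volume.prod volume) := by
    refine setIntegral_mono_on_ae ?_ hint.integrableOn hmB ?_
    · rw [IntegrableOn, hprod]
      exact Integrable.mul_prod hwi hcint
    · filter_upwards [ae_comp_snd hu.ae_zero, ae_comp_snd hv.ae_zero, ae_comp_fst hw]
        with z hz1 hz2 hz3 hz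
      have hy := hBΩ _ hz.2
      obtain ⟨d1, d2⟩ := hdist _ hz.1 _ hz.2
      rw [gagliardoIntegrand, hz1 hy, hz2 hy, sub_zero, sub_zero, div_eq_mul_inv]
      have h3 := hz3 hz.1
      have h4 := (hw0 z.1).trans h3
      gcongr
  have e3 : ∫ z in Ω ×ˢ B, gagliardoIntegrand s u v z ∂(volume.prod volume) ≤
      ∫ z, gagliardoIntegrand s u v z ∂(volume.prod volume) :=
    setIntegral_le_integral hint (Filter.Eventually.of_forall h0)
  calc _ = (∫ x in Ω, w x) * (volume.real B * (R ^ a)⁻¹) := by ring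
    _ ≤ _ := e1 ▸ e2.trans e3

/-- `u ∈ X_0^s(Ω)` solves `(-Δ)^s u = f` in the variational sense. -/
structure IsEnergySol (s : ℝ) (Ω : Set (Eu N)) (f u : Eu N → ℝ) : Prop where
  memX0 : MemX0 s Ω u
  eq_dual : ∀ v : Eu N → ℝ, MemX0 s Ω v →
    ∫ z, gagliardoIntegrand s u v z ∂(volume.prod volume) = ∫ x in Ω, f x * v x

theorem IsEnergySol.symm {f g u w : Eu N → ℝ} (hu : IsEnergySol s Ω f u)
    (hw : IsEnergySol s Ω g w) : ∫ x in Ω, f x * w x = ∫ x in Ω, g x * u x := by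
  rw [← hu.eq_dual w hw.memX0, ← hw.eq_dual u hu.memX0, gagliardoIntegrand_comm]

theorem IsEnergySol.neg {f u : Eu N → ℝ} (hs : 0 < s) (hu : IsEnergySol s Ω f u) :
    IsEnergySol s Ω (-f) (-u) where
  memX0 := hu.memX0.neg hs
  eq_dual v hv := by
    have h1 : gagliardoIntegrand s (-u) v = fun z => -gagliardoIntegrand s u v z := by
      ext z
      simp only [gagliardoIntegrand, Pi.neg_apply]
      ring
    simp only [h1, integral_neg, hu.eq_dual v hv, Pi.neg_apply, neg_mul]

/-- The graph of `gagliardoQuot` over `X_0^s(Ω)`. -/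
def energySpace (s : ℝ) (Ω : Set (Eu N)) : Submodule ℝ (WithLp 2
    (Lp ℝ 2 (volume : Measure (Eu N)) ×
      Lp ℝ 2 ((volume : Measure (Eu N)).prod (volume : Measure (Eu N))))) where
  carrier := {p | (∀ᵐ x, x ∉ Ω → p.fst x = 0) ∧
    p.snd =ᵐ[volume.prod volume] gagliardoQuot s p.fst}
  add_mem' := by
    rintro p p' ⟨h1, h2⟩ ⟨h1', h2'⟩
    have e := Lp.coeFn_add p.fst p'.fst
    refine ⟨?_, ?_⟩
    · filter_upwards [h1, h1', e] with x hx hx' hxe hxΩ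
      rw [WithLp.add_fst, hxe, Pi.add_apply, hx hxΩ, hx' hxΩ, add_zero]
    · rw [WithLp.add_fst, WithLp.add_snd]
      refine Filter.EventuallyEq.trans ?_ (gagliardoQuot_congr s e).symm
      filter_upwards [h2, h2', Lp.coeFn_add p.snd p'.snd] with z hz hz' hze
      rw [hze, Pi.add_apply, hz, hz']
      simp only [gagliardoQuot, Pi.add_apply]
      ring
  zero_mem' := by
    have e := Lp.coeFn_zero ℝ 2 (volume : Measure (Eu N))
    refine ⟨?_, ?_⟩
    · filter_upwards [e] with x hxe _
      rw [WithLp.zero_fst, hxe, Pi.zero_apply]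
    · rw [WithLp.zero_fst, WithLp.zero_snd]
      refine Filter.EventuallyEq.trans ?_ (gagliardoQuot_congr s e).symm
      filter_upwards [Lp.coeFn_zero ℝ 2
        ((volume : Measure (Eu N)).prod (volume : Measure (Eu N)))] with z hze
      rw [hze]
      simp [gagliardoQuot]
  smul_mem' := by
    rintro t p ⟨h1, h2⟩
    have e := Lp.coeFn_smul t p.fst
    refine ⟨?_, ?_⟩
    · filter_upwards [h1, e] with x hx hxe hxΩ
      rw [WithLp.smul_fst, hxe, Pi.smul_apply, hx hxΩ, smul_zero]
    · rw [WithLp.smul_fst, WithLp.smul_snd]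
      refine Filter.EventuallyEq.trans ?_ (gagliardoQuot_congr s e).symm
      filter_upwards [h2, Lp.coeFn_smul t p.snd] with z hz hze
      rw [hze, Pi.smul_apply, hz]
      simp only [gagliardoQuot, Pi.smul_apply, smul_eq_mul]
      ring

theorem isClosed_energySpace (s : ℝ) (Ω : Set (Eu N)) :
    IsClosed {p | p ∈ energySpace s Ω} := by
  refine IsSeqClosed.isClosed fun p q hp hq => ?_
  have h1 : Filter.Tendsto (fun n => (p n).fst) Filter.atTop (nhds q.fst) :=
    ((WithLp.fstL 2 ℝ _ _).continuous.tendsto q).comp hq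
  have h2 : Filter.Tendsto (fun n => (p n).snd) Filter.atTop (nhds q.snd) :=
    ((WithLp.sndL 2 ℝ _ _).continuous.tendsto q).comp hq
  obtain ⟨n₁, hn₁, hn₁'⟩ := (tendstoInMeasure_of_tendsto_Lp h1).exists_seq_tendsto_ae
  obtain ⟨n₂, hn₂, hn₂'⟩ :=
    (tendstoInMeasure_of_tendsto_Lp (h2.comp hn₁.tendsto_atTop)).exists_seq_tendsto_ae
  have hp1 : ∀ᵐ x, ∀ n, x ∉ Ω → (p n).fst x = 0 := ae_all_iff.2 fun n => (hp n).1
  have hp2 : ∀ᵐ z ∂(volume.prod volume), ∀ n, (p n).snd z = gagliardoQuot s (p n).fst z :=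
    ae_all_iff.2 fun n => (hp n).2
  refine ⟨?_, ?_⟩
  · filter_upwards [hp1, hn₁'] with x hx hlim hxΩ
    refine tendsto_nhds_unique hlim ?_
    simp only [hx _ hxΩ]
    exact tendsto_const_nhds
  · filter_upwards [hp2, hn₂', ae_comp_fst hn₁', ae_comp_snd hn₁'] with z hz hlim hz1 hz2
    refine tendsto_nhds_unique hlim ?_
    simp only [Function.comp_apply, hz]
    exact ((hz1.comp hn₂.tendsto_atTop).sub (hz2.comp hn₂.tendsto_atTop)).div_const _

theorem memX0_of_mem_energySpace (hs : 0 < s) (p : energySpace s Ω) :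
    MemX0 s Ω p.1.fst where
  memLp := Lp.memLp _
  ae_zero := p.2.1
  seminorm_finite := by
    have := (Lp.memLp p.1.snd).integrable_mul
      (Lp.memLp p.1.snd)
    refine this.congr ?_
    filter_upwards [p.2.2] with z hz
    rw [Pi.mul_apply, hz, gagliardoQuot_mul hs]

theorem inner_snd_energySpace (hs : 0 < s) (p p' : energySpace s Ω) :
    inner ℝ p.1.snd p'.1.snd =
      ∫ z, gagliardoIntegrand s p.1.fst p'.1.fst z
        ∂(volume.prod volume) := by
  rw [L2.inner_def]
  refine integral_congr_ae ?_
  filter_upwards [p.2.2, p'.2.2] with z h1 h2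
  rw [h1, h2, ← gagliardoQuot_mul hs]
  simp only [RCLike.inner_apply, conj_trivial]
  exact mul_comm _ _

theorem exists_mem_energySpace (hs : 0 < s) {u : Eu N → ℝ} (hu : MemX0 s Ω u) :
    ∃ p : energySpace s Ω, p.1.fst =ᵐ[volume] u := by
  have e := hu.memLp.coeFn_toLp
  refine ⟨⟨WithLp.toLp 2 (hu.memLp.toLp u, (hu.memLp_gagliardoQuot hs).toLp _), ?_, ?_⟩, e⟩
  · filter_upwards [hu.ae_zero, e] with x hx hxe hxΩ
    exact hxe.trans (hx hxΩ)
  · exact (hu.memLp_gagliardoQuot hs).coeFn_toLp.trans (gagliardoQuot_congr s e).symm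

end

section

variable {N : ℕ} {s : ℝ} {Ω : Set (Eu N)}

theorem exists_inner_eq_inner_of_coercive {V E F : Type*} [NormedAddCommGroup V]
    [InnerProductSpace ℝ V] [CompleteSpace V] [NormedAddCommGroup E] [InnerProductSpace ℝ E]
    [NormedAddCommGroup F] [InnerProductSpace ℝ F] (T : V →L[ℝ] E) (S : V →L[ℝ] F) (a : F)
    {C : ℝ} (hC : 0 < C) (hT : ∀ v, C * ‖v‖ ^ 2 ≤ ‖T v‖ ^ 2) :
    ∃ p, ∀ q, inner ℝ (T p) (T q) = inner ℝ a (S q) := by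
  let B : V →L[ℝ] V →L[ℝ] ℝ := (innerSL ℝ).bilinearComp T T
  let ℓ : V →L[ℝ] ℝ := (innerSL ℝ a).comp S
  have hB : IsCoercive B := ⟨C, hC, fun v => by
    have h : B v v = ‖T v‖ ^ 2 := real_inner_self_eq_norm_sq (T v)
    rw [h, mul_assoc, ← sq]
    exact hT v⟩
  refine ⟨hB.continuousLinearEquivOfBilin.symm ((InnerProductSpace.toDual ℝ V).symm ℓ),
    fun q => ?_⟩
  have h1 := hB.continuousLinearEquivOfBilin_apply
    (hB.continuousLinearEquivOfBilin.symm ((InnerProductSpace.toDual ℝ V).symm ℓ)) q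
  rw [ContinuousLinearEquiv.apply_symm_apply, InnerProductSpace.toDual_symm_apply] at h1
  exact h1.symm

theorem exists_isEnergySol (hs : 0 < s) (hN : 2 * s < (N : ℝ)) (hb : Bornology.IsBounded Ω)
    (hm : MeasurableSet Ω) {f : Eu N → ℝ} (hf : MemLp f 2 (volume.restrict Ω)) :
    ∃ u, IsEnergySol s Ω f u := by
  obtain ⟨c, hc, hcoer⟩ := exists_coercivity_const hs hN hb hm
  have : CompleteSpace (energySpace s Ω) := (isClosed_energySpace s Ω).completeSpace_coe
  have hF : MemLp (Ω.indicator f) 2 (volume : Measure (Eu N)) := (memLp_indicator_iff_restrict hm).2 hf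
  have hB : ∀ p : energySpace s Ω, c / (1 + c) * ‖p‖ ^ 2 ≤ ‖p.1.snd‖ ^ 2 := by
    intro p
    have h1 := inner_snd_energySpace hs p p
    have hp := memX0_of_mem_energySpace hs p
    have hn : ‖p.1.fst‖ ^ 2 = ∫ x in Ω, p.1.fst x * p.1.fst x := by
      rw [← real_inner_self_eq_norm_sq, L2.inner_def,
        ← setIntegral_eq_integral_of_ae_compl_eq_zero (s := Ω)]
      · simp only [RCLike.inner_apply, conj_trivial]
      · filter_upwards [p.2.1] with x hx hxΩ
        simp [hx hxΩ]
    have h2 := hcoer p.1.fst p.1.fst (fun x => p.1.fst x * p.1.fst x) hp hp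
      (Filter.Eventually.of_forall fun x _ => le_rfl)
      (fun z => by rw [← gagliardoQuot_mul hs]; exact mul_self_nonneg _)
      ((hp.memLp.integrable_mul hp.memLp).integrableOn) (fun x => mul_self_nonneg _)
    rw [← h1, ← hn, real_inner_self_eq_norm_sq] at h2
    have h3 : ‖p‖ ^ 2 = ‖p.1.fst‖ ^ 2 + ‖p.1.snd‖ ^ 2 := WithLp.prod_norm_sq_eq_of_L2 p.1
    rw [h3, div_mul_eq_mul_div, div_le_iff₀ (by positivity)]
    linarith
  obtain ⟨p, hp⟩ := exists_inner_eq_inner_of_coercive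
    ((WithLp.sndL 2 ℝ _ _).comp (energySpace s Ω).subtypeL)
    ((WithLp.fstL 2 ℝ _ _).comp (energySpace s Ω).subtypeL) (hF.toLp _)
    (div_pos hc (by positivity : 0 < 1 + c)) hB
  refine ⟨p.1.fst, memX0_of_mem_energySpace hs p, fun v hv => ?_⟩
  obtain ⟨q, hq⟩ := exists_mem_energySpace hs hv
  have h1 : inner ℝ p.1.snd q.1.snd =
      ∫ z, gagliardoIntegrand s p.1.fst v z ∂(volume.prod volume) := by
    refine (inner_snd_energySpace hs p q).trans (integral_congr_ae ?_)
    filter_upwards [gagliardoQuot_congr s hq] with z hz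
    rw [← gagliardoQuot_mul hs, hz, gagliardoQuot_mul hs]
  have h2 : inner ℝ (hF.toLp _) q.1.fst = ∫ x in Ω, f x * v x := by
    rw [L2.inner_def, ← integral_indicator hm]
    refine integral_congr_ae ?_
    filter_upwards [hq, hF.coeFn_toLp] with x h3 h4
    rw [h4, h3]
    by_cases hx : x ∈ Ω <;> simp [hx, mul_comm]
  rw [← h1, ← h2]
  exact hp q

theorem sub_mul_sub_posPart_nonneg (M a b : ℝ) :
    0 ≤ (a - b) * (max (a - M) 0 - max (b - M) 0) := by
  rcases le_total b a with h | h
  · exact mul_nonneg (sub_nonneg.2 h) (sub_nonneg.2 (max_le_max_right _ (by linarith)))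
  · exact mul_nonneg_of_nonpos_of_nonpos (sub_nonpos.2 h)
      (sub_nonpos.2 (max_le_max_right _ (by linarith)))

/-- The maximum principle: variational solutions with bounded data are bounded. -/
theorem exists_bound_energySol (hs : 0 < s) (hN : 2 * s < (N : ℝ)) (hb : Bornology.IsBounded Ω)
    (hm : MeasurableSet Ω) (K : ℝ) (hK : 0 ≤ K) : ∃ M : ℝ, 0 ≤ M ∧ ∀ f u : Eu N → ℝ,
      AEStronglyMeasurable f (volume.restrict Ω) → (∀ᵐ x ∂(volume.restrict Ω), |f x| ≤ K) →
      IsEnergySol s Ω f u → ∀ᵐ x, |u x| ≤ M := by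
  obtain ⟨c, hc, hcoer⟩ := exists_coercivity_const hs hN hb hm
  set M := (K + 1) / c with hM
  have hM0 : 0 ≤ M := by positivity
  have key : ∀ f u : Eu N → ℝ, AEStronglyMeasurable f (volume.restrict Ω) →
      (∀ᵐ x ∂(volume.restrict Ω), |f x| ≤ K) →
      IsEnergySol s Ω f u → ∀ᵐ x, u x ≤ M := by
    intro f u hfm hf hu
    set k : Eu N → ℝ := fun x => max (u x - M) 0 with hk
    have hk0 : ∀ x, 0 ≤ k x := fun x => le_max_right _ _
    have hkX : MemX0 s Ω k := by
      refine hu.memX0.of_gagliardoQuot_le hs ?_ (fun x => ?_) (fun x y => ?_)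
      · exact ((hu.memX0.memLp.1.sub aestronglyMeasurable_const).sup aestronglyMeasurable_const)
      · rw [abs_of_nonneg (hk0 x)]
        exact max_le (by linarith [le_abs_self (u x)]) (abs_nonneg _)
      · refine (abs_max_sub_max_le_abs _ _ _).trans_eq ?_
        congr 1
        ring
    have hki : IntegrableOn k Ω := by
      have : IsFiniteMeasure (volume.restrict Ω) := isFiniteMeasure_restrict.2 hb.measure_lt_top.ne
      exact (hkX.memLp.restrict Ω).integrable (by norm_num)
    have h1 := hcoer u k (fun x => M * k x) hu.memX0 hkX
      (Filter.Eventually.of_forall fun x _ => by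
        rcases le_total (u x) M with h | h
        · simp [hk, h]
        · exact mul_le_mul_of_nonneg_right h (hk0 x))
      (fun z => div_nonneg (sub_mul_sub_posPart_nonneg M _ _) (by positivity))
      (hki.const_mul M) (fun x => mul_nonneg hM0 (hk0 x))
    rw [hu.eq_dual k hkX, integral_const_mul, ← mul_assoc] at h1
    have h2 : ∫ x in Ω, f x * k x ≤ ∫ x in Ω, K * k x := by
      refine integral_mono_ae (hki.bdd_mul hfm hf) (hki.const_mul K) ?_
      filter_upwards [hf] with x hx
      exact mul_le_mul_of_nonneg_right ((le_abs_self _).trans hx) (hk0 x)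
    rw [integral_const_mul] at h2
    have h3 : c * M = K + 1 := by rw [hM]; field_simp
    rw [h3] at h1
    have h4 : ∫ x in Ω, k x = 0 :=
      le_antisymm (by linarith) (integral_nonneg hk0)
    have h5 := (integral_eq_zero_iff_of_nonneg hk0 hki).1 h4
    rw [Filter.EventuallyEq, ae_restrict_iff' hm] at h5
    filter_upwards [h5, hu.memX0.ae_zero] with x hx hx0
    by_cases hxΩ : x ∈ Ω
    · have : max (u x - M) 0 = 0 := hx hxΩ
      linarith [le_max_left (u x - M) 0]
    · rw [hx0 hxΩ]
      exact hM0
  refine ⟨M, hM0, fun f u hfm hf hu => ?_⟩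
  filter_upwards [key f u hfm hf hu,
    key (-f) (-u) hfm.neg (by simpa using hf) (hu.neg hs)] with x h1 h2
  exact abs_le.2 ⟨by rw [Pi.neg_apply] at h2; linarith, h1⟩

end

section

variable {N : ℕ} {s : ℝ} {Ω : Set (Eu N)}

/-! ### Weak solutions with integrable data -/

theorem IsEnergySol.add_const_mul (hs : 0 < s) {f g u w : Eu N → ℝ} (t : ℝ)
    (hf : MemLp f 2 (volume.restrict Ω)) (hg : MemLp g 2 (volume.restrict Ω))
    (hu : IsEnergySol s Ω f u) (hw : IsEnergySol s Ω g w) :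
    IsEnergySol s Ω (fun x => f x + t * g x) (fun x => u x + t * w x) := by
  have hq : gagliardoQuot s (fun x => u x + t * w x) =
      gagliardoQuot s u + t • gagliardoQuot s w := by
    ext z
    simp only [gagliardoQuot, Pi.add_apply, Pi.smul_apply, smul_eq_mul]
    ring
  have hI : ∀ v, gagliardoIntegrand s (fun x => u x + t * w x) v =
      fun z => gagliardoIntegrand s u v z + t * gagliardoIntegrand s w v z := by
    intro v
    ext z
    rw [← gagliardoQuot_mul hs, hq, Pi.add_apply, Pi.smul_apply, smul_eq_mul, add_mul, mul_assoc,
      gagliardoQuot_mul hs, gagliardoQuot_mul hs]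
  refine ⟨⟨hu.memX0.memLp.add (hw.memX0.memLp.const_mul t), ?_, ?_⟩, fun v hv => ?_⟩
  · filter_upwards [hu.memX0.ae_zero, hw.memX0.ae_zero] with x h1 h2 hx
    rw [h1 hx, h2 hx, mul_zero, add_zero]
  · have h := (hu.memX0.memLp_gagliardoQuot hs).add
      ((hw.memX0.memLp_gagliardoQuot hs).const_smul t)
    rw [← hq] at h
    refine (h.integrable_mul h).congr (Filter.Eventually.of_forall fun z => ?_)
    rw [Pi.mul_apply, gagliardoQuot_mul hs]
  · have hv2 : MemLp v 2 (volume.restrict Ω) := hv.memLp.restrict Ω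
    simp only [hI, add_mul, mul_assoc]
    rw [integral_add (hu.memX0.integrable_gagliardoIntegrand hs hv)
      ((hw.memX0.integrable_gagliardoIntegrand hs hv).const_mul t), integral_const_mul,
      hu.eq_dual v hv, hw.eq_dual v hv, ← integral_const_mul, ← integral_add]
    · exact hf.integrable_mul hv2
    · exact (hg.integrable_mul hv2).const_mul t

theorem IsTestFun.exists_bound {h : Eu N → ℝ} (hh : IsTestFun Ω h) :
    ∃ K : ℝ, 0 ≤ K ∧ ∀ x, |h x| ≤ K := by
  obtain ⟨K, hK⟩ := hh.compact_support.exists_bound_of_continuous hh.smooth.continuous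
  exact ⟨K, (norm_nonneg _).trans (hK 0), hK⟩

theorem IsTestFun.memLp {h : Eu N → ℝ} (hh : IsTestFun Ω h) (r : ℝ≥0∞) :
    MemLp h r (volume.restrict Ω) :=
  (hh.smooth.continuous.memLp_of_hasCompactSupport hh.compact_support).restrict Ω

theorem IsTestFun.eq_zero {h : Eu N → ℝ} (hh : IsTestFun Ω h) {x : Eu N} (hx : x ∉ Ω) :
    h x = 0 :=
  image_eq_zero_of_notMem_tsupport fun h' => hx (hh.support_subset h')

theorem IsTestFun.exists_testFracLap (hs : 0 < s) (hN : 2 * s < (N : ℝ))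
    (hb : Bornology.IsBounded Ω) (hm : MeasurableSet Ω) {h : Eu N → ℝ} (hh : IsTestFun Ω h) :
    ∃ φ, TestFracLap s Ω φ h := by
  obtain ⟨φ, hφ⟩ := exists_isEnergySol hs hN hb hm (hh.memLp 2)
  exact ⟨φ, hφ.memX0, hh, hφ.eq_dual⟩

theorem TestFracLap.isEnergySol {φ h : Eu N → ℝ} (hφ : TestFracLap s Ω φ h) :
    IsEnergySol s Ω h φ := ⟨hφ.memX0, hφ.eq_dual⟩

theorem TestFracLap.exists_bound (hs : 0 < s) (hN : 2 * s < (N : ℝ))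
    (hb : Bornology.IsBounded Ω) (hm : MeasurableSet Ω) {φ h : Eu N → ℝ}
    (hφ : TestFracLap s Ω φ h) : ∃ M : ℝ, 0 ≤ M ∧ ∀ᵐ x ∂(volume.restrict Ω), |φ x| ≤ M := by
  obtain ⟨K, hK, hK'⟩ := hφ.isTestFun.exists_bound
  obtain ⟨M, hM, hM'⟩ := exists_bound_energySol hs hN hb hm K hK
  exact ⟨M, hM, ae_restrict_of_ae (hM' h φ (hφ.isTestFun.memLp 2).1
    (Filter.Eventually.of_forall hK') hφ.isEnergySol)⟩

theorem TestFracLap.integrable_mul (hs : 0 < s) (hN : 2 * s < (N : ℝ))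
    (hb : Bornology.IsBounded Ω) (hm : MeasurableSet Ω) {φ h : Eu N → ℝ}
    (hφ : TestFracLap s Ω φ h) {f : Eu N → ℝ} (hf : IntegrableOn f Ω) :
    IntegrableOn (fun x => f x * φ x) Ω := by
  obtain ⟨M, -, hM⟩ := hφ.exists_bound hs hN hb hm
  exact Integrable.mul_bdd hf hφ.memX0.memLp.1.restrict hM

theorem IsTestFun.integrable_mul {f h : Eu N → ℝ} (hh : IsTestFun Ω h) (hf : IntegrableOn f Ω) :
    IntegrableOn (fun x => f x * h x) Ω := by
  obtain ⟨K, -, hK⟩ := hh.exists_bound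
  exact Integrable.mul_bdd hf (hh.memLp 2).1 (Filter.Eventually.of_forall hK)

theorem exists_bdryDist_le (hb : Bornology.IsBounded Ω) :
    ∃ D : ℝ, ∀ x ∈ Ω, bdryDist Ω x ≤ D := by
  rcases (frontier Ω).eq_empty_or_nonempty with h | ⟨y, hy⟩
  · exact ⟨0, fun x _ => by simp [bdryDist, h]⟩
  · obtain ⟨r, hr⟩ := hb.subset_closedBall y
    exact ⟨r, fun x hx => (Metric.infDist_le_dist_of_mem hy).trans (hr hx)⟩

/-- For integrable data all integrals in the definition of a weak solution converge. -/
theorem isL1WeakSol_of_integrableOn (hs : 0 < s) (hN : 2 * s < (N : ℝ))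
    (hb : Bornology.IsBounded Ω) (hm : MeasurableSet Ω) {f u : Eu N → ℝ}
    (hf : IntegrableOn f Ω) (hu : IntegrableOn u Ω)
    (h : ∀ φ h, TestFracLap s Ω φ h → ∫ x in Ω, u x * h x = ∫ x in Ω, f x * φ x) :
    IsL1WeakSol s Ω f u where
  integrable_sol := hu
  integrable_data := by
    obtain ⟨D, hD⟩ := exists_bdryDist_le hb
    refine Integrable.mul_bdd (c := D ^ s) hf ?_ ?_
    · exact ((Metric.continuous_infDist_pt _).rpow_const
        (fun _ => Or.inr hs.le)).aestronglyMeasurable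
    · refine ae_restrict_of_forall_mem hm fun x hx => ?_
      have h0 : 0 ≤ bdryDist Ω x := Metric.infDist_nonneg
      rw [Real.norm_of_nonneg (Real.rpow_nonneg h0 _)]
      exact Real.rpow_le_rpow Metric.infDist_nonneg (hD x hx) hs.le
  integrable_test _ _ hφ := hφ.integrable_mul hs hN hb hm hf
  weak_eq := h

theorem ae_eq_zero_of_integral_mul_testFun (ho : IsOpen Ω) {u : Eu N → ℝ}
    (hu : IntegrableOn u Ω) (h : ∀ h, IsTestFun Ω h → ∫ x in Ω, u x * h x = 0) :
    u =ᵐ[volume.restrict Ω] 0 := by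
  rw [Filter.EventuallyEq, ae_restrict_iff' ho.measurableSet]
  refine ho.ae_eq_zero_of_integral_contDiff_smul_eq_zero hu.locallyIntegrableOn
    fun k h1 h2 h3 => ?_
  have hk : IsTestFun Ω k := ⟨h1, h2, h3⟩
  rw [← h k hk, ← setIntegral_eq_integral_of_forall_compl_eq_zero (s := Ω)]
  · simp only [smul_eq_mul, mul_comm]
  · intro x hx
    rw [hk.eq_zero hx, zero_smul]

theorem IsL1WeakSol.ae_eq (hs : 0 < s) (hN : 2 * s < (N : ℝ))
    (hb : Bornology.IsBounded Ω) (ho : IsOpen Ω) {f u u' : Eu N → ℝ}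
    (hu : IsL1WeakSol s Ω f u) (hu' : IsL1WeakSol s Ω f u') :
    u =ᵐ[volume.restrict Ω] u' := by
  have key := ae_eq_zero_of_integral_mul_testFun ho
    (hu.integrable_sol.sub hu'.integrable_sol) fun h hh => by
      obtain ⟨φ, hφ⟩ := hh.exists_testFracLap hs hN hb ho.measurableSet
      simp only [Pi.sub_apply, sub_mul]
      rw [integral_sub (hh.integrable_mul hu.integrable_sol)
        (hh.integrable_mul hu'.integrable_sol), hu.weak_eq φ h hφ, hu'.weak_eq φ h hφ, sub_self]
  filter_upwards [key] with x hx
  exact sub_eq_zero.1 hx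

theorem IsL1WeakSol.congr_data {f f' u : Eu N → ℝ} (hu : IsL1WeakSol s Ω f u)
    (h : f =ᵐ[volume.restrict Ω] f') : IsL1WeakSol s Ω f' u where
  integrable_sol := hu.integrable_sol
  integrable_data := hu.integrable_data.congr (h.mul (ae_eq_refl _))
  integrable_test φ _ hφ := (hu.integrable_test φ _ hφ).congr (h.mul (ae_eq_refl _))
  weak_eq φ k hφ := (hu.weak_eq φ k hφ).trans (integral_congr_ae (h.mul (ae_eq_refl _)))

theorem IsL1WeakSol.add_const_mul {f g u w : Eu N → ℝ} (t : ℝ) (hu : IsL1WeakSol s Ω f u)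
    (hw : IsL1WeakSol s Ω g w) :
    IsL1WeakSol s Ω (fun x => f x + t * g x) (fun x => u x + t * w x) where
  integrable_sol := hu.integrable_sol.add (hw.integrable_sol.const_mul t)
  integrable_data := (hu.integrable_data.add (hw.integrable_data.const_mul t)).congr
    (Filter.Eventually.of_forall fun x => by simp only [Pi.add_apply]; ring)
  integrable_test φ k hφ := ((hu.integrable_test φ k hφ).add
    ((hw.integrable_test φ k hφ).const_mul t)).congr
    (Filter.Eventually.of_forall fun x => by simp only [Pi.add_apply]; ring)
  weak_eq φ k hφ := by
    simp only [add_mul, mul_assoc]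
    rw [integral_add (hφ.isTestFun.integrable_mul hu.integrable_sol)
      ((hφ.isTestFun.integrable_mul hw.integrable_sol).const_mul t),
      integral_add (hu.integrable_test φ k hφ) ((hw.integrable_test φ k hφ).const_mul t),
      integral_const_mul, integral_const_mul, hu.weak_eq φ k hφ, hw.weak_eq φ k hφ]

theorem IsEnergySol.isL1WeakSol (hs : 0 < s) (hN : 2 * s < (N : ℝ))
    (hb : Bornology.IsBounded Ω) (hm : MeasurableSet Ω) {f u : Eu N → ℝ}
    (hf : MemLp f 2 (volume.restrict Ω)) (hu : IsEnergySol s Ω f u) : IsL1WeakSol s Ω f u := by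
  have : IsFiniteMeasure (volume.restrict Ω) := isFiniteMeasure_restrict.2 hb.measure_lt_top.ne
  refine isL1WeakSol_of_integrableOn hs hN hb hm (hf.integrable (by norm_num))
    ((hu.memX0.memLp.restrict Ω).integrable (by norm_num)) fun φ h hφ => ?_
  rw [hu.symm hφ.isEnergySol]
  simp only [mul_comm]

/-- The solution operator is bounded on `L^1(Ω)`, by duality with its boundedness on `L^∞`. -/
theorem exists_integral_abs_le (hs : 0 < s) (hN : 2 * s < (N : ℝ))
    (hb : Bornology.IsBounded Ω) (hm : MeasurableSet Ω) : ∃ M : ℝ, 0 ≤ M ∧ ∀ f u : Eu N → ℝ,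
      MemLp f 2 (volume.restrict Ω) → IsEnergySol s Ω f u →
      ∫ x in Ω, |u x| ≤ M * ∫ x in Ω, |f x| := by
  have : IsFiniteMeasure (volume.restrict Ω) := isFiniteMeasure_restrict.2 hb.measure_lt_top.ne
  obtain ⟨M, hM0, hM⟩ := exists_bound_energySol hs hN hb hm 1 zero_le_one
  refine ⟨M, hM0, fun f u hf hu => ?_⟩
  have hsm : Measurable (fun r : ℝ => (SignType.sign r : ℝ)) := by
    have : (fun r : ℝ => (SignType.sign r : ℝ)) =
        fun r => if 0 < r then 1 else if r < 0 then -1 else 0 := by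
      ext r
      rw [sign_apply]
      split_ifs <;> simp
    rw [this]
    exact Measurable.ite measurableSet_Ioi measurable_const
      (Measurable.ite measurableSet_Iio measurable_const measurable_const)
  set σ : Eu N → ℝ := fun x => (SignType.sign (u x) : ℝ) with hσ
  have hσm : AEStronglyMeasurable σ (volume.restrict Ω) :=
    (hsm.comp_aemeasurable hu.memX0.memLp.1.aemeasurable.restrict).aestronglyMeasurable
  have hσ1 : ∀ᵐ x ∂(volume.restrict Ω), |σ x| ≤ 1 := by
    refine Filter.Eventually.of_forall fun x => ?_
    rcases lt_trichotomy (u x) 0 with h | h | h <;> simp [hσ, h]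
  obtain ⟨w, hw⟩ := exists_isEnergySol hs hN hb hm (MemLp.of_bound (p := 2) hσm 1 hσ1)
  have hwM := ae_restrict_of_ae (s := Ω) (hM σ w hσm hσ1 hw)
  have hfi : Integrable f (volume.restrict Ω) := hf.integrable (by norm_num)
  have e : ∫ x in Ω, |u x| = ∫ x in Ω, f x * w x := by
    rw [hu.symm hw]
    simp only [hσ, sign_mul_self]
  rw [e, ← integral_const_mul]
  refine integral_mono_ae (hfi.mul_bdd hw.memX0.memLp.1.restrict hwM) (hfi.abs.const_mul M) ?_
  filter_upwards [hwM] with x hx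
  calc f x * w x ≤ |f x| * |w x| := by rw [← abs_mul]; exact le_abs_self _
    _ ≤ |f x| * M := by gcongr
    _ = _ := mul_comm _ _

theorem tendsto_integral_mul_of_tendsto_L1 {α : Type*} [MeasurableSpace α] {μ : Measure α}
    {F : ℕ → Lp ℝ 1 μ} {G : Lp ℝ 1 μ} (h : Filter.Tendsto F Filter.atTop (nhds G))
    {φ : α → ℝ} (hφ : AEStronglyMeasurable φ μ) {M : ℝ} (hM : ∀ᵐ x ∂μ, |φ x| ≤ M) :
    Filter.Tendsto (fun n => ∫ x, F n x * φ x ∂μ) Filter.atTop (nhds (∫ x, G x * φ x ∂μ)) := by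
  rw [tendsto_iff_norm_sub_tendsto_zero] at h ⊢
  refine squeeze_zero (fun _ => norm_nonneg _) (fun n => ?_) (by simpa using h.const_mul M)
  have i1 := (L1.integrable_coeFn (F n)).mul_bdd hφ hM
  have i2 := (L1.integrable_coeFn G).mul_bdd hφ hM
  rw [← integral_sub i1 i2, L1.norm_eq_integral_norm, ← integral_const_mul]
  refine norm_integral_le_of_norm_le ((L1.integrable_coeFn _).norm.const_mul M) ?_
  filter_upwards [hM, Lp.coeFn_sub (F n) G] with x h1 h2
  rw [h2, Pi.sub_apply, ← sub_mul, norm_mul, mul_comm]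
  gcongr
  exact h1

/-- Variational solutions for data converging in `L^1(Ω)` converge to a weak solution, almost
everywhere along a subsequence. -/
theorem exists_isL1WeakSol_of_tendsto (hs : 0 < s) (hN : 2 * s < (N : ℝ))
    (hb : Bornology.IsBounded Ω) (hm : MeasurableSet Ω) {f : Eu N → ℝ} (hf : IntegrableOn f Ω)
    {g u : ℕ → Eu N → ℝ} (hg2 : ∀ n, MemLp (g n) 2 (volume.restrict Ω))
    (hu : ∀ n, IsEnergySol s Ω (g n) (u n))
    (hg : Filter.Tendsto (fun n => ∫ x in Ω, |g n x - f x|) Filter.atTop (nhds 0)) :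
    ∃ w, IsL1WeakSol s Ω f w ∧ ∃ ns : ℕ → ℕ, StrictMono ns ∧
      ∀ᵐ x ∂(volume.restrict Ω),
        Filter.Tendsto (fun k => u (ns k) x) Filter.atTop (nhds (w x)) := by
  have : IsFiniteMeasure (volume.restrict Ω) := isFiniteMeasure_restrict.2 hb.measure_lt_top.ne
  obtain ⟨C, hC0, hC⟩ := exists_integral_abs_le hs hN hb hm
  have hfi : Integrable f (volume.restrict Ω) := hf
  have hg1 : ∀ n, Integrable (g n) (volume.restrict Ω) := fun n =>
    (hg2 n).integrable (by norm_num)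
  have hu1 : ∀ n, Integrable (u n) (volume.restrict Ω) := fun n =>
    ((hu n).memX0.memLp.restrict Ω).integrable (by norm_num)
  set G : ℕ → Lp ℝ 1 (volume.restrict Ω) := fun n => (hg1 n).toL1 (g n) with hG
  set U : ℕ → Lp ℝ 1 (volume.restrict Ω) := fun n => (hu1 n).toL1 (u n) with hU
  have hGf : Filter.Tendsto G Filter.atTop (nhds (hfi.toL1 f)) := by
    rw [tendsto_iff_dist_tendsto_zero]
    refine hg.congr fun n => ?_
    rw [dist_eq_norm, ← Integrable.toL1_sub, L1.norm_of_fun_eq_integral_norm]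
    rfl
  have hdist : ∀ m n, dist (U m) (U n) ≤ C * dist (G m) (G n) := by
    intro m n
    rw [dist_eq_norm, dist_eq_norm, ← Integrable.toL1_sub, ← Integrable.toL1_sub,
      L1.norm_of_fun_eq_integral_norm, L1.norm_of_fun_eq_integral_norm]
    have h := hC _ _ ((hg2 m).add ((hg2 n).const_mul (-1)))
      ((hu m).add_const_mul hs (-1) (hg2 m) (hg2 n) (hu n))
    simpa only [neg_one_mul, ← sub_eq_add_neg, Pi.add_apply, Pi.sub_apply, Real.norm_eq_abs]
      using h
  have hcau : CauchySeq U := by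
    rw [Metric.cauchySeq_iff]
    intro ε hε
    obtain ⟨n₀, h⟩ := Metric.cauchySeq_iff.1 hGf.cauchySeq (ε / (C + 1)) (by positivity)
    refine ⟨n₀, fun m hm n hn => (hdist m n).trans_lt ?_⟩
    have h1 := h m hm n hn
    rw [lt_div_iff₀ (by positivity)] at h1
    nlinarith [dist_nonneg (x := G m) (y := G n)]
  obtain ⟨V, hV⟩ := cauchySeq_tendsto_of_complete hcau
  obtain ⟨ns, hns, hns'⟩ := (tendstoInMeasure_of_tendsto_Lp hV).exists_seq_tendsto_ae
  refine ⟨V, isL1WeakSol_of_integrableOn hs hN hb hm hf (L1.integrable_coeFn V)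
    fun φ h hφ => ?_, ns, hns, ?_⟩
  · obtain ⟨K, -, hK⟩ := hφ.isTestFun.exists_bound
    obtain ⟨M, -, hM⟩ := hφ.exists_bound hs hN hb hm
    have l1 := tendsto_integral_mul_of_tendsto_L1 hV (hφ.isTestFun.memLp 2).1
      (Filter.Eventually.of_forall hK)
    have l2 := tendsto_integral_mul_of_tendsto_L1 hGf hφ.memX0.memLp.1.restrict hM
    have e : (fun n => ∫ x in Ω, U n x * h x) = fun n => ∫ x in Ω, G n x * φ x := by
      ext n
      have e1 : ∫ x in Ω, U n x * h x = ∫ x in Ω, u n x * h x :=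
        integral_congr_ae ((hu1 n).coeFn_toL1.mul (ae_eq_refl h))
      have e2 : ∫ x in Ω, G n x * φ x = ∫ x in Ω, g n x * φ x :=
        integral_congr_ae ((hg1 n).coeFn_toL1.mul (ae_eq_refl φ))
      rw [e1, e2]
      exact ((hu n).isL1WeakSol hs hN hb hm (hg2 n)).weak_eq φ h hφ
    rw [e] at l1
    rw [tendsto_nhds_unique l1 l2]
    exact integral_congr_ae (hfi.coeFn_toL1.mul (ae_eq_refl φ))
  · filter_upwards [hns', ae_all_iff.2 fun n => (hu1 n).coeFn_toL1] with x h1 h2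
    simpa only [hU, h2] using h1

/-- Truncation of real numbers at height `n`. -/
def clip (n : ℕ) (r : ℝ) : ℝ := max (-n) (min r n)

theorem abs_clip_le (n : ℕ) (r : ℝ) : |clip n r| ≤ n :=
  abs_le.2 ⟨le_max_left _ _,
    max_le (by linarith [(Nat.cast_nonneg n : (0 : ℝ) ≤ n)]) (min_le_right _ _)⟩

theorem clip_eq {n : ℕ} {r : ℝ} (h : |r| ≤ n) : clip n r = r := by
  rw [clip, min_eq_left (abs_le.1 h).2, max_eq_right (abs_le.1 h).1]

theorem abs_clip_le_abs (n : ℕ) (r : ℝ) : |clip n r| ≤ |r| := by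
  rcases le_total |r| n with h | h
  · rw [clip_eq h]
  · exact (abs_clip_le n r).trans h

theorem eventually_clip_eq (r : ℝ) : ∀ᶠ n : ℕ in Filter.atTop, clip n r = r := by
  obtain ⟨n₀, hn₀⟩ := exists_nat_ge |r|
  filter_upwards [Filter.eventually_ge_atTop n₀] with n hn
  exact clip_eq (hn₀.trans (by exact_mod_cast hn))

theorem continuous_clip (n : ℕ) : Continuous (clip n) := by
  unfold clip
  fun_prop

theorem tendsto_integral_abs_clip_sub {α : Type*} [MeasurableSpace α] {μ : Measure α} {f : α → ℝ}
    (hf : Integrable f μ) :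
    Filter.Tendsto (fun n : ℕ => ∫ x, |clip n (f x) - f x| ∂μ) Filter.atTop (nhds 0) := by
  have h := tendsto_integral_of_dominated_convergence (μ := μ)
    (F := fun (n : ℕ) x => |clip n (f x) - f x|) (f := fun _ => 0) (fun x => 2 * |f x|)
    (fun n => (((continuous_clip n).comp_aestronglyMeasurable hf.1).sub hf.1).norm)
    (hf.abs.const_mul 2) (fun n => Filter.Eventually.of_forall fun x => ?_)
    (Filter.Eventually.of_forall fun x => ?_)
  · simpa using h
  · rw [Real.norm_eq_abs, abs_abs]
    linarith [abs_sub (clip n (f x)) (f x), abs_clip_le_abs n (f x)]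
  · refine tendsto_const_nhds.congr' ?_
    filter_upwards [eventually_clip_eq (f x)] with n hn
    rw [hn, sub_self, abs_zero]

theorem memLp_clip (hb : Bornology.IsBounded Ω) {f : Eu N → ℝ}
    (hf : AEStronglyMeasurable f (volume.restrict Ω)) (n : ℕ) (r : ℝ≥0∞) :
    MemLp (fun x => clip n (f x)) r (volume.restrict Ω) := by
  have : IsFiniteMeasure (volume.restrict Ω) := isFiniteMeasure_restrict.2 hb.measure_lt_top.ne
  exact MemLp.of_bound ((continuous_clip n).comp_aestronglyMeasurable hf) n
    (Filter.Eventually.of_forall fun x => abs_clip_le n (f x))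

theorem exists_isL1WeakSol (hs : 0 < s) (hN : 2 * s < (N : ℝ))
    (hb : Bornology.IsBounded Ω) (hm : MeasurableSet Ω) {f : Eu N → ℝ} (hf : IntegrableOn f Ω) :
    ∃ u, IsL1WeakSol s Ω f u := by
  choose u hu using fun n => exists_isEnergySol hs hN hb hm (memLp_clip hb hf.1 n 2)
  obtain ⟨w, hw, -⟩ := exists_isL1WeakSol_of_tendsto hs hN hb hm hf
    (fun n => memLp_clip hb hf.1 n 2) hu (tendsto_integral_abs_clip_sub hf)
  exact ⟨w, hw⟩

theorem invFracLap_spec (hs : 0 < s) (hN : 2 * s < (N : ℝ))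
    (hb : Bornology.IsBounded Ω) (hm : MeasurableSet Ω) {f : Eu N → ℝ} (hf : IntegrableOn f Ω) :
    IsL1WeakSol s Ω f (invFracLap s Ω f) := by
  have h := exists_isL1WeakSol hs hN hb hm hf
  rw [invFracLap, dif_pos h]
  exact h.choose_spec

end

section

/-! ### Bounds by the level set method -/

/-- Stampacchia's lemma. -/
theorem eq_zero_of_level_decay {m : ℝ → ℝ} {C m₀ δ d : ℝ} (hm : Antitone m)
    (hpos : ∀ k, 0 ≤ m k) (hδ : 0 < δ) (hC : 0 ≤ C) (hm₀ : 0 ≤ m₀) (h0 : m 0 ≤ m₀)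
    (hdec : ∀ k h, 0 ≤ k → k < h → (h - k) * m h ≤ C * m k ^ (1 + δ)) (hd : 0 < d)
    (hdC : 2 * C * m₀ ^ δ ≤ d * (1 / 2) ^ (1 / δ)) : m d = 0 := by
  set b : ℝ := (1 / 2) ^ (1 / δ) with hb
  have hb0 : 0 < b := by positivity
  have hb1 : b < 1 := Real.rpow_lt_one (by norm_num) (by norm_num) (by positivity)
  have hbδ : b ^ δ = 1 / 2 := by
    rw [hb, ← Real.rpow_mul (by norm_num), one_div_mul_cancel hδ.ne', Real.rpow_one]
  have key : ∀ n : ℕ, m (d * (1 - (1 / 2) ^ n)) ≤ m₀ * b ^ n := by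
    intro n
    induction n with
    | zero => simpa using h0
    | succ n ih =>
      have hp : (0 : ℝ) < (1 / 2) ^ n := by positivity
      have hp1 : ((1 : ℝ) / 2) ^ n ≤ 1 := pow_le_one₀ (by norm_num) (by norm_num)
      have e1 : d * (1 - (1 / 2) ^ (n + 1)) - d * (1 - (1 / 2) ^ n) = d * (1 / 2) ^ n / 2 := by
        ring
      have h1 := hdec (d * (1 - (1 / 2) ^ n)) (d * (1 - (1 / 2) ^ (n + 1)))
        (mul_nonneg hd.le (by linarith)) (by
          have : 0 < d * (1 / 2) ^ n / 2 := by positivity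
          linarith)
      rw [e1] at h1
      have h2 : m (d * (1 - (1 / 2) ^ n)) ^ (1 + δ) ≤ (m₀ * b ^ n) ^ (1 + δ) :=
        Real.rpow_le_rpow (hpos _) ih (by positivity)
      have h3 : (m₀ * b ^ n) ^ (1 + δ) ≤ m₀ * b ^ n * (m₀ ^ δ * (1 / 2) ^ n) := by
        rcases hm₀.eq_or_lt with h | h
        · rw [← h]
          simp [Real.zero_rpow (by positivity : 1 + δ ≠ 0)]
        · rw [Real.rpow_add (by positivity), Real.rpow_one, Real.mul_rpow hm₀ (by positivity),
            ← Real.rpow_natCast b n, ← Real.rpow_mul hb0.le, mul_comm (n : ℝ) δ,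
            Real.rpow_mul hb0.le, hbδ, Real.rpow_natCast, Real.rpow_natCast]
      have h4 := h1.trans (mul_le_mul_of_nonneg_left (h2.trans h3) hC)
      have h5 : C * (m₀ * b ^ n * (m₀ ^ δ * (1 / 2) ^ n)) ≤
          d * (1 / 2) ^ n / 2 * (m₀ * b ^ (n + 1)) := by
        have := mul_le_mul_of_nonneg_left hdC
          (by positivity : 0 ≤ m₀ * b ^ n * (1 / 2) ^ n / 2)
        rw [pow_succ b]
        linarith
      exact le_of_mul_le_mul_left (h4.trans h5) (by positivity)
  have hlim : Filter.Tendsto (fun n : ℕ => m₀ * b ^ n) Filter.atTop (nhds 0) := by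
    simpa using (tendsto_pow_atTop_nhds_zero_of_lt_one hb0.le hb1).const_mul m₀
  refine le_antisymm (ge_of_tendsto' hlim fun n => (hm ?_).trans (key n)) (hpos d)
  have : (0 : ℝ) < (1 / 2) ^ n := by positivity
  nlinarith

variable {N : ℕ} {s : ℝ} {Ω : Set (Eu N)}

theorem IsEnergySol.exists_measurable (hs : 0 < s) (hΩ : MeasurableSet Ω) {f u : Eu N → ℝ}
    (hu : IsEnergySol s Ω f u) :
    ∃ u', Measurable u' ∧ (∀ x ∉ Ω, u' x = 0) ∧ u =ᵐ[volume] u' ∧ IsEnergySol s Ω f u' := by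
  have hm := hu.memX0.memLp.1
  have e : u =ᵐ[volume] Ω.indicator (hm.mk u) := by
    filter_upwards [hm.ae_eq_mk, hu.memX0.ae_zero] with x h1 h2
    by_cases hx : x ∈ Ω
    · rw [Set.indicator_of_mem hx, h1]
    · rw [Set.indicator_of_notMem hx, h2 hx]
  have hI : ∀ v, gagliardoIntegrand s u v =ᵐ[volume.prod volume]
      gagliardoIntegrand s (Ω.indicator (hm.mk u)) v := by
    intro v
    filter_upwards [gagliardoQuot_congr s e] with z hz
    rw [← gagliardoQuot_mul hs, hz, gagliardoQuot_mul hs]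
  refine ⟨_, hm.stronglyMeasurable_mk.measurable.indicator hΩ,
    fun x hx => Set.indicator_of_notMem hx _, e, ⟨hu.memX0.memLp.ae_eq e, ?_, ?_⟩, fun v hv => ?_⟩
  · filter_upwards [hu.memX0.ae_zero, e] with x h1 h2 hx
    rw [← h2, h1 hx]
  · refine hu.memX0.seminorm_finite.congr ?_
    filter_upwards [gagliardoQuot_congr s e] with z hz
    rw [← gagliardoQuot_mul hs, hz, gagliardoQuot_mul hs]
  · rw [← hu.eq_dual v hv]
    exact (integral_congr_ae (hI v)).symm

/-- Comparison principle. -/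
theorem IsEnergySol.nonneg (hs : 0 < s) (hN : 2 * s < (N : ℝ)) (hb : Bornology.IsBounded Ω)
    (hm : MeasurableSet Ω) {f u : Eu N → ℝ} (hf : ∀ x, 0 ≤ f x) (hu : IsEnergySol s Ω f u) :
    ∀ᵐ x, 0 ≤ u x := by
  obtain ⟨c, hc, hcoer⟩ := exists_coercivity_const hs hN hb hm
  set k : Eu N → ℝ := fun x => max (-u x) 0 with hk
  have hkX : MemX0 s Ω k := by
    refine hu.memX0.of_gagliardoQuot_le hs (hu.memX0.memLp.1.neg.sup aestronglyMeasurable_const)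
      (fun x => ?_) (fun x y => ?_)
    · rw [abs_of_nonneg (le_max_right _ _)]
      exact max_le (neg_le_abs _) (abs_nonneg _)
    · refine (abs_max_sub_max_le_abs _ _ _).trans_eq ?_
      rw [neg_sub_neg, abs_sub_comm]
  have hk2 : Integrable (fun x => k x * k x) (volume.restrict Ω) :=
    (hkX.memLp.restrict Ω).integrable_mul (hkX.memLp.restrict Ω)
  have h1 := hcoer (-u) k (fun x => k x * k x) (hu.memX0.neg hs) hkX
    (Filter.Eventually.of_forall fun x _ => by
      rcases le_total (-u x) 0 with h | h <;> simp [hk, h])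
    (fun z => div_nonneg (by
      have := sub_mul_sub_posPart_nonneg 0 (-u z.1) (-u z.2)
      simpa only [sub_zero, hk, Pi.neg_apply] using this) (by positivity)) hk2 (fun x => mul_self_nonneg _)
  rw [(hu.neg hs).eq_dual k hkX] at h1
  have h2 : ∫ x in Ω, (-f) x * k x ≤ 0 :=
    integral_nonpos fun x => mul_nonpos_of_nonpos_of_nonneg (by simpa using hf x)
      (le_max_right _ _)
  have h3 : ∫ x in Ω, k x * k x = 0 :=
    le_antisymm (by nlinarith) (integral_nonneg fun x => mul_self_nonneg _)
  have h4 := (integral_eq_zero_iff_of_nonneg (fun x => mul_self_nonneg (k x)) hk2).1 h3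
  rw [Filter.EventuallyEq, ae_restrict_iff' hm] at h4
  filter_upwards [h4, hu.memX0.ae_zero] with x h5 h6
  by_cases hx : x ∈ Ω
  · have h7 : max (-u x) 0 = 0 := mul_self_eq_zero.1 (h5 hx)
    linarith [le_max_left (-u x) 0]
  · rw [h6 hx]

/-- A set of finite measure interacts with its complement at least as much as a ball does. -/
theorem exists_interaction_const (hs : 0 < s) (hN : 2 * s < (N : ℝ)) :
    ∃ c : ℝ, 0 < c ∧ ∀ (D A : Set (Eu N)) (u v : Eu N → ℝ) (κ : ℝ), MeasurableSet D →
      MeasurableSet A → D ⊆ A → volume A ≠ ⊤ → 0 ≤ κ →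
      Integrable (gagliardoIntegrand s u v) (volume.prod volume) →
      (∀ z, 0 ≤ gagliardoIntegrand s u v z) →
      (∀ x ∈ D, ∀ y ∉ A, κ ≤ (u x - u y) * (v x - v y)) →
      c * κ * volume.real D ≤ volume.real A ^ (2 * s / N) *
        ∫ z, gagliardoIntegrand s u v z ∂(volume.prod volume) := by
  have hN0 : (0 : ℝ) < N := by linarith
  have : Nonempty (Fin N) := ⟨⟨0, by exact_mod_cast hN0⟩⟩
  set τ := volume.real (Metric.ball (0 : Eu N) 1) with hτ
  have hτ0 : 0 < τ :=
    ENNReal.toReal_pos (Metric.measure_ball_pos _ _ one_pos).ne' measure_ball_lt_top.ne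
  refine ⟨((2 / τ) ^ (1 + 2 * s / N))⁻¹, by positivity,
    fun D A u v κ hD hA hDA hAfin hκ hint h0 hle => ?_⟩
  have hDfin : volume D ≠ ⊤ := measure_ne_top_of_subset hDA hAfin
  set m := volume.real A with hm
  rcases (measureReal_nonneg : 0 ≤ m).eq_or_lt with hm0 | hm0
  · have hD0 : volume.real D = 0 :=
      le_antisymm (hm0 ▸ measureReal_mono hDA hAfin) measureReal_nonneg
    rw [hD0, mul_zero]
    exact mul_nonneg (Real.rpow_nonneg hm0.le _) (integral_nonneg h0)
  set R := (2 * m / τ) ^ (1 / (N : ℝ)) with hR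
  have hR0 : 0 < R := by positivity
  have hball : ∀ x : Eu N, volume.real (Metric.ball x R) = 2 * m := by
    intro x
    rw [measureReal_def, Measure.addHaar_ball _ _ hR0.le, ENNReal.toReal_mul,
      ENNReal.toReal_ofReal (by positivity), ← measureReal_def, finrank_euclideanSpace,
      Fintype.card_fin, hR, ← Real.rpow_natCast, ← Real.rpow_mul (by positivity),
      one_div_mul_cancel hN0.ne', Real.rpow_one, ← hτ, div_mul_cancel₀ _ hτ0.ne']
  set S : Set (Eu N × Eu N) := {z | z.1 ∈ D ∧ z.2 ∉ A ∧ dist z.2 z.1 < R} with hS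
  have hSm : MeasurableSet S :=
    (measurable_fst hD).inter ((measurable_snd hA).compl.inter
      (measurableSet_lt (measurable_snd.dist measurable_fst) measurable_const))
  have hslice : ∀ x ∈ D, Prod.mk x ⁻¹' S = Metric.ball x R \ A := by
    intro x hx
    ext y
    simp only [hS, Set.mem_preimage, Set.mem_ofPred_eq, Set.mem_sdiff, Metric.mem_ball, hx,
      true_and, and_comm]
  have hslice' : ∀ x ∉ D, Prod.mk x ⁻¹' S = ∅ := by
    intro x hx
    ext y
    simp [hS, hx]
  have hSeq : (volume.prod volume) S = ∫⁻ x in D, volume (Metric.ball x R \ A) := by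
    rw [Measure.prod_apply hSm, ← lintegral_indicator hD]
    refine lintegral_congr fun x => ?_
    by_cases hx : x ∈ D
    · rw [Set.indicator_of_mem hx, hslice x hx]
    · rw [Set.indicator_of_notMem hx, hslice' x hx, measure_empty]
  have hbd : ∀ x : Eu N, volume (Metric.ball x R) = ENNReal.ofReal (2 * m) := fun x => by
    rw [← hball x, ofReal_measureReal measure_ball_lt_top.ne]
  have hSfin : (volume.prod volume) S ≠ ⊤ := by
    refine ne_top_of_le_ne_top (b := ENNReal.ofReal (2 * m) * volume D)
      (ENNReal.mul_ne_top ENNReal.ofReal_ne_top hDfin) ?_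
    rw [hSeq, ← setLIntegral_const]
    exact lintegral_mono fun x => (measure_mono Set.sdiff_subset).trans (hbd x).le
  have hSge : m * volume.real D ≤ (volume.prod volume).real S := by
    have h1 : ENNReal.ofReal m * volume D ≤ (volume.prod volume) S := by
      rw [hSeq, ← setLIntegral_const]
      refine lintegral_mono fun x => ?_
      have h2 := le_measure_sdiff (μ := volume) (s₁ := Metric.ball x R) (s₂ := A)
      rw [hbd, ← ofReal_measureReal hAfin, ← hm, ← ENNReal.ofReal_sub _ hm0.le] at h2
      rwa [two_mul, add_sub_cancel_right] at h2
    have h3 := ENNReal.toReal_mono hSfin h1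
    rwa [ENNReal.toReal_mul, ENNReal.toReal_ofReal hm0.le] at h3
  have hlow : κ / R ^ ((N : ℝ) + 2 * s) * (volume.prod volume).real S ≤
      ∫ z, gagliardoIntegrand s u v z ∂(volume.prod volume) := by
    refine (setIntegral_ge_of_const_le_real hSm hSfin (fun z hz => ?_) hint.integrableOn).trans
      (setIntegral_le_integral hint (Filter.Eventually.of_forall h0))
    have hne : 0 < ‖z.1 - z.2‖ := by
      rw [norm_pos_iff, sub_ne_zero]
      intro h
      exact hz.2.1 (h ▸ hDA hz.1)
    have hle' : ‖z.1 - z.2‖ ≤ R := by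
      rw [← dist_eq_norm, dist_comm]
      exact hz.2.2.le
    have h1 := hle _ hz.1 _ hz.2.1
    rw [gagliardoIntegrand]
    have h2 := hκ.trans h1
    gcongr
  have hRa : R ^ ((N : ℝ) + 2 * s) = (2 / τ) ^ (1 + 2 * s / N) * (m * m ^ (2 * s / N)) := by
    rw [hR, ← Real.rpow_mul (by positivity), ← Real.rpow_one_add' hm0.le (by positivity),
      ← Real.mul_rpow (by positivity) hm0.le]
    congr 1
    · ring
    · field_simp
  have h1 : κ / R ^ ((N : ℝ) + 2 * s) * (m * volume.real D) ≤
      ∫ z, gagliardoIntegrand s u v z ∂(volume.prod volume) :=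
    (mul_le_mul_of_nonneg_left hSge (by positivity)).trans hlow
  have h2 := mul_le_mul_of_nonneg_left h1 (by positivity : 0 ≤ m ^ (2 * s / N))
  refine le_trans (le_of_eq ?_) h2
  rw [hRa]
  have hm1 : m ≠ 0 := hm0.ne'
  have hm2 : m ^ (2 * s / N) ≠ 0 := by positivity
  field_simp

/-- The solution operator maps `L^μ(Ω)` to `L^∞(Ω)` for `1/μ = η < 2s/N`; integrability of the
data is expressed by the resulting bound for integrals over subsets. -/
theorem exists_sup_bound (hs : 0 < s) (hN : 2 * s < (N : ℝ)) (hb : Bornology.IsBounded Ω)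
    (hm : MeasurableSet Ω) {η : ℝ} (hη : η < 2 * s / N) :
    ∃ C : ℝ, 0 < C ∧ ∀ (f u : Eu N → ℝ) (Φ : ℝ), 0 < Φ → (∀ x, 0 ≤ f x) → IntegrableOn f Ω →
      (∀ A, MeasurableSet A →
        ∫ x in Ω ∩ A, f x ≤ Φ * volume.real (Ω ∩ A) ^ (1 - η)) →
      IsEnergySol s Ω f u → ∀ᵐ x, u x ≤ C * Φ := by
  have hN0 : (0 : ℝ) < N := by linarith
  have hγ : 2 * s / N < 1 := (div_lt_one hN0).2 hN
  obtain ⟨c, hc, hint⟩ := exists_interaction_const (N := N) hs hN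
  set δ := 2 * s / N - η with hδ
  have hδ0 : 0 < δ := sub_pos.2 hη
  set m₀ := volume.real Ω with hm₀
  have hm₀' : 0 ≤ m₀ := measureReal_nonneg
  set b : ℝ := (1 / 2) ^ (1 / δ) with hbdef
  have hb0 : 0 < b := by positivity
  refine ⟨2 * m₀ ^ δ / (c * b) + 1, by positivity, fun f u Φ hΦ hf hfi hA hu => ?_⟩
  obtain ⟨w, hwm, hw0, huw, hw⟩ := hu.exists_measurable hs hm
  set d := (2 * m₀ ^ δ / (c * b) + 1) * Φ with hd
  have hd0 : 0 < d := by positivity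
  have hfin : ∀ k : ℝ, volume (Ω ∩ {x | k < w x}) ≠ ⊤ := fun k =>
    measure_ne_top_of_subset Set.inter_subset_left hb.measure_lt_top.ne
  have hzero : volume.real (Ω ∩ {x | d < w x}) = 0 := by
    refine eq_zero_of_level_decay (m := fun k => volume.real (Ω ∩ {x | k < w x})) (C := Φ / c)
      (m₀ := m₀) (δ := δ) (fun k h hkh => measureReal_mono
        (Set.inter_subset_inter_right _ fun x hx => lt_of_le_of_lt hkh hx) (hfin k))
      (fun _ => measureReal_nonneg) hδ0 (by positivity) hm₀'
      (measureReal_mono Set.inter_subset_left hb.measure_lt_top.ne) (fun k h hk hkh => ?_) hd0 ?_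
    · set A := Ω ∩ {x | k < w x} with hAdef
      set v : Eu N → ℝ := fun x => min (max (w x - k) 0) (h - k) with hv
      have hkh' : 0 < h - k := sub_pos.2 hkh
      have hv0 : ∀ x, 0 ≤ v x := fun x => le_min (le_max_right _ _) hkh'.le
      have hvX : MemX0 s Ω v := by
        refine hw.memX0.of_gagliardoQuot_le hs (((hwm.sub measurable_const).max
          measurable_const).min measurable_const).aestronglyMeasurable (fun x => ?_)
          (fun x y => ?_)
        · rw [abs_of_nonneg (hv0 x)]
          exact (min_le_left _ _).trans (max_le (by linarith [le_abs_self (w x)])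
            (abs_nonneg _))
        · refine (abs_min_sub_min_le_max _ _ _ _).trans ?_
          rw [sub_self, abs_zero]
          refine max_le ((abs_max_sub_max_le_max _ _ _ _).trans ?_) (abs_nonneg _)
          rw [sub_self, abs_zero, sub_sub_sub_cancel_right]
          exact max_le le_rfl (abs_nonneg _)
      have hmonov : ∀ x y, w y ≤ w x → v y ≤ v x := fun x y hxy =>
        min_le_min_right _ (max_le_max_right _ (by linarith))
      have h1 := hint (Ω ∩ {x | h < w x}) A w v ((h - k) ^ 2)
        (hm.inter (measurableSet_lt measurable_const hwm))
        (hm.inter (measurableSet_lt measurable_const hwm))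
        (Set.inter_subset_inter_right _ fun x hx => hkh.trans hx) (hfin k) (sq_nonneg _)
        (hw.memX0.integrable_gagliardoIntegrand hs hvX)
        (fun z => div_nonneg (by
          rcases le_total (w z.1) (w z.2) with hz | hz
          · exact mul_nonneg_of_nonpos_of_nonpos (by linarith) (by linarith [hmonov _ _ hz])
          · exact mul_nonneg (by linarith) (by linarith [hmonov _ _ hz])) (by positivity))
        (fun x hx y hy => by
          have hwx : h < w x := hx.2
          have hwy : w y ≤ k := by
            by_cases hyΩ : y ∈ Ω
            · exact not_lt.1 fun h' => hy ⟨hyΩ, h'⟩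
            · rw [hw0 y hyΩ]
              exact hk
          have e1 : v x = h - k :=
            min_eq_right ((by linarith : h - k ≤ w x - k).trans (le_max_left _ _))
          have e2 : v y = 0 := by
            simp only [hv]
            rw [max_eq_right (by linarith), min_eq_left hkh'.le]
          rw [e1, e2, sub_zero, sq]
          exact mul_le_mul_of_nonneg_right (by linarith) hkh'.le)
      rw [hw.eq_dual v hvX] at h1
      have h2 : ∫ x in Ω, f x * v x ≤ (h - k) * ∫ x in Ω ∩ {x | k < w x}, f x := by
        rw [← integral_const_mul, ← setIntegral_indicator (measurableSet_lt measurable_const hwm)]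
        have hvm : AEStronglyMeasurable v (volume.restrict Ω) := hvX.memLp.1.restrict
        refine integral_mono (Integrable.mul_bdd (c := h - k) hfi hvm
          (Filter.Eventually.of_forall fun x => ?_))
          ((hfi.const_mul (h - k)).indicator (measurableSet_lt measurable_const hwm))
          fun x => ?_
        · rw [Real.norm_of_nonneg (hv0 x)]
          exact min_le_right _ _
        · by_cases hx : k < w x
          · simp only [Set.indicator_of_mem (show x ∈ {x | k < w x} from hx)]
            rw [mul_comm]
            exact mul_le_mul_of_nonneg_right (min_le_right _ _) (hf x)
          · simp only [Set.indicator_of_notMem (show x ∉ {x | k < w x} from hx)]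
            have : v x = 0 := by
              simp only [hv]
              rw [max_eq_right (by linarith), min_eq_left hkh'.le]
            rw [this, mul_zero]
      have h3 := h2.trans (mul_le_mul_of_nonneg_left
        (hA _ (measurableSet_lt measurable_const hwm)) hkh'.le)
      have h4 := h1.trans (mul_le_mul_of_nonneg_left h3
        (Real.rpow_nonneg measureReal_nonneg _))
      have h5 : volume.real A ^ (1 + δ) =
          volume.real A ^ (2 * s / N) * volume.real A ^ (1 - η) := by
        rw [← Real.rpow_add_of_nonneg measureReal_nonneg (by positivity) (by linarith)]
        congr 1
        rw [hδ]
        ring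
      rw [h5, div_mul_eq_mul_div, le_div_iff₀ hc]
      refine le_of_mul_le_mul_left ?_ hkh'
      linarith
    · rw [← hbdef, hd, div_eq_mul_inv, div_eq_mul_inv, mul_inv]
      have h1 : 0 ≤ Φ * b := by positivity
      have h2 : b⁻¹ * b = 1 := inv_mul_cancel₀ hb0.ne'
      calc 2 * (Φ * c⁻¹) * m₀ ^ δ = 2 * m₀ ^ δ * (c⁻¹ * (b⁻¹ * b)) * Φ := by rw [h2]; ring
        _ ≤ 2 * m₀ ^ δ * (c⁻¹ * (b⁻¹ * b)) * Φ + Φ * b := by linarith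
        _ = _ := by ring
  have hnull : volume (Ω ∩ {x | d < w x}) = 0 :=
    (measureReal_eq_zero_iff (hfin d)).1 hzero
  filter_upwards [huw, measure_eq_zero_iff_ae_notMem.1 hnull] with x h1 h2
  rw [h1]
  by_cases hx : x ∈ Ω
  · exact not_lt.1 fun h => h2 ⟨hx, h⟩
  · rw [hw0 x hx]
    exact hd0.le

end

section

/-! ### Convergence of the quadratic form -/

variable {N : ℕ} {s : ℝ} {Ω : Set (Eu N)}

theorem memLp_of_bounded (hb : Bornology.IsBounded Ω) {f : Eu N → ℝ} {K : ℝ}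
    (hf : AEStronglyMeasurable f (volume.restrict Ω)) (hK : ∀ x, |f x| ≤ K) (r : ℝ≥0∞) :
    MemLp f r (volume.restrict Ω) := by
  have : IsFiniteMeasure (volume.restrict Ω) := isFiniteMeasure_restrict.2 hb.measure_lt_top.ne
  exact MemLp.of_bound hf K (Filter.Eventually.of_forall hK)

theorem setIntegral_inter_rpow_le (hb : Bornology.IsBounded Ω) {f : Eu N → ℝ} {K : ℝ}
    (hf : AEStronglyMeasurable f (volume.restrict Ω)) (h0 : ∀ x, 0 ≤ f x) (hK : ∀ x, f x ≤ K)
    {r η : ℝ} (hr : 0 < r) (hη : 0 < η) (hη1 : η < 1) (A : Set (Eu N)) :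
    ∫ x in Ω ∩ A, f x ^ (r * η) ≤
      (∫ x in Ω, f x ^ r) ^ η * volume.real (Ω ∩ A) ^ (1 - η) := by
  have : IsFiniteMeasure (volume.restrict Ω) := isFiniteMeasure_restrict.2 hb.measure_lt_top.ne
  have hfin : IsFiniteMeasure (volume.restrict (Ω ∩ A)) :=
    isFiniteMeasure_restrict.2 (hb.subset Set.inter_subset_left).measure_lt_top.ne
  have hpow : ∀ t : ℝ, 0 < t → MemLp (fun x => f x ^ t) ∞ (volume.restrict Ω) := fun t ht =>
    memLp_top_of_bound (hf.aemeasurable.pow_const t).aestronglyMeasurable (K ^ t)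
      (Filter.Eventually.of_forall fun x => by
        rw [Real.norm_of_nonneg (Real.rpow_nonneg (h0 x) _)]
        exact Real.rpow_le_rpow (h0 x) (hK x) ht.le)
  have hmono : volume.restrict (Ω ∩ A) ≤ volume.restrict Ω :=
    Measure.restrict_mono Set.inter_subset_left le_rfl
  have hconj : (1 / η).HolderConjugate (1 / (1 - η)) := by
    rw [Real.holderConjugate_iff]
    refine ⟨(one_lt_div hη).2 hη1, ?_⟩
    rw [one_div, one_div, inv_inv, inv_inv]
    ring
  have h := integral_mul_le_Lp_mul_Lq_of_nonneg (μ := volume.restrict (Ω ∩ A)) hconj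
    (f := fun x => f x ^ (r * η)) (g := fun _ => (1 : ℝ))
    (Filter.Eventually.of_forall fun x => Real.rpow_nonneg (h0 x) _)
    (Filter.Eventually.of_forall fun x => zero_le_one)
    (((hpow _ (by positivity)).mono_measure hmono).mono_exponent le_top) (memLp_const 1)
  have e : ∀ x, (f x ^ (r * η)) ^ η⁻¹ = f x ^ r := fun x => by
    rw [← Real.rpow_mul (h0 x), mul_inv_cancel_right₀ hη.ne']
  simp only [mul_one, e, Real.one_rpow, one_div, inv_inv] at h
  rw [setIntegral_const, smul_eq_mul, mul_one] at h
  refine h.trans (mul_le_mul_of_nonneg_right ?_ (Real.rpow_nonneg measureReal_nonneg _))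
  refine Real.rpow_le_rpow (integral_nonneg fun x => Real.rpow_nonneg (h0 x) _) ?_ hη.le
  exact setIntegral_mono_set ((hpow r hr).integrable le_top)
    (Filter.Eventually.of_forall fun x => Real.rpow_nonneg (h0 x) _)
    (Set.inter_subset_left : Ω ∩ A ≤ Ω).eventuallyLE

/-- The interpolation inequality between the exponents `(t, rη)` and `(tη, r)`. -/
theorem mul_le_rpow_interpolate {a b r t η θ : ℝ} (ha : 0 ≤ a) (hb : 0 ≤ b)
    (hθ0 : 0 ≤ θ) (hθ1 : θ ≤ 1) (e1 : t * θ + t * η * (1 - θ) = 1)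
    (e2 : r * η * θ + r * (1 - θ) = 1) (ht : 0 < t) (hr : 0 < r) (hη : 0 < η) :
    a * b ≤ θ * (a ^ t * b ^ (r * η)) + (1 - θ) * (a ^ (t * η) * b ^ r) := by
  have h := Real.geom_mean_le_arith_mean2_weighted hθ0 (sub_nonneg.2 hθ1)
    (by positivity : 0 ≤ a ^ t * b ^ (r * η)) (by positivity : 0 ≤ a ^ (t * η) * b ^ r) (by ring)
  refine le_trans (le_of_eq ?_) h
  have hθ1' : 0 ≤ 1 - θ := sub_nonneg.2 hθ1
  rw [Real.mul_rpow (by positivity) (by positivity), Real.mul_rpow (by positivity) (by positivity),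
    ← Real.rpow_mul ha, ← Real.rpow_mul ha, ← Real.rpow_mul hb, ← Real.rpow_mul hb,
    mul_mul_mul_comm, ← Real.rpow_add_of_nonneg ha (by positivity) (by positivity),
    ← Real.rpow_add_of_nonneg hb (by positivity) (by positivity), e1, e2, Real.rpow_one,
    Real.rpow_one]

/-- The subcritical bound for the quadratic form of the solution operator on `L^r × L^t`,
`1 < 1/r + 1/t < 1 + 2s/N`, for bounded data. -/
theorem exists_bilinear_bound (hs : 0 < s) (hN : 2 * s < (N : ℝ)) (hb : Bornology.IsBounded Ω)
    (hm : MeasurableSet Ω) {r t η θ : ℝ} (hr : 0 < r) (ht : 0 < t) (hη : 0 < η)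
    (hη' : η < 2 * s / N) (hθ0 : 0 ≤ θ) (hθ1 : θ ≤ 1) (e1 : t * θ + t * η * (1 - θ) = 1)
    (e2 : r * η * θ + r * (1 - θ) = 1) :
    ∃ C : ℝ, 0 ≤ C ∧ ∀ (f g u : Eu N → ℝ) (K F G : ℝ),
      AEStronglyMeasurable f (volume.restrict Ω) → AEStronglyMeasurable g (volume.restrict Ω) →
      (∀ x, 0 ≤ f x) → (∀ x, 0 ≤ g x) → (∀ x, f x ≤ K) → (∀ x, g x ≤ K) →
      IsEnergySol s Ω f u → ∫ x in Ω, f x ^ r ≤ F → ∫ x in Ω, g x ^ t ≤ G →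
      ∫ x in Ω, g x * u x ≤ C * (G * (F ^ η + 1) + F * (G ^ η + 1)) := by
  have hN0 : (0 : ℝ) < N := by linarith
  have hη1 : η < 1 := hη'.trans ((div_lt_one hN0).2 hN)
  obtain ⟨C, hC, hCb⟩ := exists_sup_bound hs hN hb hm hη'
  refine ⟨C, hC.le, fun f g u K F G hfm hgm hf0 hg0 hfK hgK hu hF hG => ?_⟩
  have : IsFiniteMeasure (volume.restrict Ω) := isFiniteMeasure_restrict.2 hb.measure_lt_top.ne
  have hpow : ∀ (f : Eu N → ℝ), AEStronglyMeasurable f (volume.restrict Ω) → (∀ x, 0 ≤ f x) →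
      (∀ x, f x ≤ K) → ∀ a : ℝ, 0 < a → ∀ ρ, MemLp (fun x => f x ^ a) ρ (volume.restrict Ω) :=
    fun f hfm hf0 hfK a ha ρ => memLp_of_bounded hb
      (hfm.aemeasurable.pow_const a).aestronglyMeasurable (K := K ^ a) (fun x => by
        rw [abs_of_nonneg (Real.rpow_nonneg (hf0 x) _)]
        exact Real.rpow_le_rpow (hf0 x) (hfK x) ha.le) ρ
  have hsup : ∀ (f w : Eu N → ℝ) (r F : ℝ), AEStronglyMeasurable f (volume.restrict Ω) →
      (∀ x, 0 ≤ f x) → (∀ x, f x ≤ K) → 0 < r → ∫ x in Ω, f x ^ r ≤ F →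
      IsEnergySol s Ω (fun x => f x ^ (r * η)) w → ∀ᵐ x, w x ≤ C * (F ^ η + 1) := by
    intro f w r F hfm hf0 hfK hr hF hw
    have hI : 0 ≤ ∫ x in Ω, f x ^ r := integral_nonneg fun x => Real.rpow_nonneg (hf0 x) _
    have hF0 : 0 ≤ F := hI.trans hF
    refine hCb _ w _ (by positivity) (fun x => Real.rpow_nonneg (hf0 x) _)
      ((hpow f hfm hf0 hfK _ (by positivity) 1).integrable le_rfl) (fun A _ => ?_) hw
    refine (setIntegral_inter_rpow_le hb hfm hf0 hfK hr hη hη1 A).trans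
      (mul_le_mul_of_nonneg_right ?_ (Real.rpow_nonneg measureReal_nonneg _))
    have := Real.rpow_le_rpow hI hF hη.le
    linarith
  have p1 := hpow f hfm hf0 hfK (r * η) (by positivity)
  have p2 := hpow f hfm hf0 hfK r hr
  have q1 := hpow g hgm hg0 hgK t ht
  have q2 := hpow g hgm hg0 hgK (t * η) (by positivity)
  have pf : MemLp f 2 (volume.restrict Ω) := memLp_of_bounded hb hfm (K := K)
    (fun x => by rw [abs_of_nonneg (hf0 x)]; exact hfK x) 2
  have qg : MemLp g 2 (volume.restrict Ω) := memLp_of_bounded hb hgm (K := K)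
    (fun x => by rw [abs_of_nonneg (hg0 x)]; exact hgK x) 2
  obtain ⟨u₁, hu₁⟩ := exists_isEnergySol hs hN hb hm (p1 2)
  obtain ⟨u₂, hu₂⟩ := exists_isEnergySol hs hN hb hm (p2 2)
  obtain ⟨w, hw⟩ := exists_isEnergySol hs hN hb hm (q2 2)
  have hu₁b := hsup f u₁ r F hfm hf0 hfK hr hF hu₁
  have hwb := hsup g w t G hgm hg0 hgK ht hG hw
  have hle : ∀ a : ℝ, 0 ≤ a → ∀ᵐ x,
      a * u x ≤ θ * (a ^ t * u₁ x) + (1 - θ) * (a ^ (t * η) * u₂ x) := by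
    intro a ha
    have h2 := hu₁.add_const_mul hs (θ * a ^ t - 1) (p1 2) (p1 2) hu₁
    have h3 := h2.add_const_mul hs ((1 - θ) * a ^ (t * η))
      ((p1 2).add ((p1 2).const_mul (θ * a ^ t - 1))) (p2 2) hu₂
    have h4 := h3.add_const_mul hs (-a)
      (((p1 2).add ((p1 2).const_mul (θ * a ^ t - 1))).add
        ((p2 2).const_mul ((1 - θ) * a ^ (t * η)))) pf hu
    filter_upwards [h4.nonneg hs hN hb hm fun x => by
      have := mul_le_rpow_interpolate ha (hf0 x) hθ0 hθ1 e1 e2 ht hr hη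
      simp only [Pi.add_apply]
      linarith] with x hx
    linarith
  have hall : ∀ᵐ x, ∀ ρ : ℚ,
      |(ρ : ℝ)| * u x ≤ θ * (|(ρ : ℝ)| ^ t * u₁ x) + (1 - θ) * (|(ρ : ℝ)| ^ (t * η) * u₂ x) :=
    ae_all_iff.2 fun ρ => hle _ (abs_nonneg _)
  have hpt : ∀ᵐ x, g x * u x ≤
      θ * (g x ^ t * u₁ x) + (1 - θ) * (g x ^ (t * η) * u₂ x) := by
    filter_upwards [hall] with x hx
    have hclosed : IsClosed {a : ℝ |
        |a| * u x ≤ θ * (|a| ^ t * u₁ x) + (1 - θ) * (|a| ^ (t * η) * u₂ x)} := by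
      refine isClosed_le (by fun_prop) ?_
      have c1 : Continuous fun a : ℝ => |a| ^ t :=
        continuous_abs.rpow_const fun _ => Or.inr ht.le
      have c2 : Continuous fun a : ℝ => |a| ^ (t * η) :=
        continuous_abs.rpow_const fun _ => Or.inr (by positivity)
      fun_prop
    have h := closure_minimal (Set.range_subset_iff.2 hx) hclosed
      (Rat.denseRange_cast (𝕜 := ℝ) (g x))
    rwa [Set.mem_ofPred_eq, abs_of_nonneg (hg0 x)] at h
  have m2 : ∀ v : Eu N → ℝ, MemX0 s Ω v → MemLp v 2 (volume.restrict Ω) := fun v hv =>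
    hv.memLp.restrict Ω
  have i0 : Integrable (fun x => g x * u x) (volume.restrict Ω) :=
    qg.integrable_mul (m2 _ hu.memX0)
  have i1 : Integrable (fun x => g x ^ t * u₁ x) (volume.restrict Ω) :=
    (q1 2).integrable_mul (m2 _ hu₁.memX0)
  have i2 : Integrable (fun x => g x ^ (t * η) * u₂ x) (volume.restrict Ω) :=
    (q2 2).integrable_mul (m2 _ hu₂.memX0)
  have i3 : Integrable (fun x => f x ^ r * w x) (volume.restrict Ω) :=
    (p2 2).integrable_mul (m2 _ hw.memX0)
  have j0 := integral_mono_ae i0 ((i1.const_mul θ).add (i2.const_mul (1 - θ)))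
    (ae_restrict_of_ae hpt)
  simp only [Pi.add_apply] at j0
  rw [integral_add (i1.const_mul θ) (i2.const_mul (1 - θ)), integral_const_mul,
    integral_const_mul, hw.symm hu₂] at j0
  have hF0 : 0 ≤ F := (integral_nonneg fun x => Real.rpow_nonneg (hf0 x) _).trans hF
  have hG0 : 0 ≤ G := (integral_nonneg fun x => Real.rpow_nonneg (hg0 x) _).trans hG
  have j1 : ∫ x in Ω, g x ^ t * u₁ x ≤ G * (C * (F ^ η + 1)) := by
    calc ∫ x in Ω, g x ^ t * u₁ x ≤ ∫ x in Ω, g x ^ t * (C * (F ^ η + 1)) := by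
          refine integral_mono_ae i1 (((q1 1).integrable le_rfl).mul_const _) ?_
          filter_upwards [ae_restrict_of_ae hu₁b] with x hx
          exact mul_le_mul_of_nonneg_left hx (Real.rpow_nonneg (hg0 x) _)
      _ = (∫ x in Ω, g x ^ t) * (C * (F ^ η + 1)) := integral_mul_const _ _
      _ ≤ _ := mul_le_mul_of_nonneg_right hG (by positivity)
  have j2 : ∫ x in Ω, f x ^ r * w x ≤ F * (C * (G ^ η + 1)) := by
    calc ∫ x in Ω, f x ^ r * w x ≤ ∫ x in Ω, f x ^ r * (C * (G ^ η + 1)) := by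
          refine integral_mono_ae i3 (((p2 1).integrable le_rfl).mul_const _) ?_
          filter_upwards [ae_restrict_of_ae hwb] with x hx
          exact mul_le_mul_of_nonneg_left hx (Real.rpow_nonneg (hf0 x) _)
      _ = (∫ x in Ω, f x ^ r) * (C * (G ^ η + 1)) := integral_mul_const _ _
      _ ≤ _ := mul_le_mul_of_nonneg_right hF (by positivity)
  have k1 : 0 ≤ G * (C * (F ^ η + 1)) := by positivity
  have k2 : 0 ≤ F * (C * (G ^ η + 1)) := by positivity
  have l1 := mul_le_mul_of_nonneg_left j1 hθ0
  have l2 := mul_le_mul_of_nonneg_left j2 (sub_nonneg.2 hθ1)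
  nlinarith

/-- For `f ∈ L^r(Ω)` and `g ∈ L^t(Ω)` with `1 < 1/r + 1/t < 1 + 2s/N`, `r, t > 1`, the solution
with data `f` is integrable against `g`. -/
theorem integrable_mul_isL1WeakSol (hs : 0 < s) (hN : 2 * s < (N : ℝ))
    (hb : Bornology.IsBounded Ω) (ho : IsOpen Ω) {r t : ℝ} (hr : 1 < r) (ht : 1 < t)
    (hrt : 1 < 1 / r + 1 / t) (hrt' : 1 / r + 1 / t < 1 + 2 * s / N) {f g u : Eu N → ℝ}
    (hfi : IntegrableOn f Ω) (hgm : AEStronglyMeasurable g (volume.restrict Ω))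
    (hf : IntegrableOn (fun x => |f x| ^ r) Ω) (hg : IntegrableOn (fun x => |g x| ^ t) Ω)
    (hu : IsL1WeakSol s Ω f u) : IntegrableOn (fun x => g x * u x) Ω := by
  have hm := ho.measurableSet
  have hN0 : (0 : ℝ) < N := by linarith
  have hγ : 2 * s / N < 1 := (div_lt_one hN0).2 hN
  have hr0 : 0 < r := by linarith
  have ht0 : 0 < t := by linarith
  set η := 1 / r + 1 / t - 1 with hη
  have hη0 : 0 < η := by linarith
  have hη1 : 0 < 1 - η := by linarith
  have hr1 : 1 / r < 1 := (div_lt_one hr0).2 hr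
  have ht1 : 1 / t < 1 := (div_lt_one ht0).2 ht
  set θ := (1 - 1 / r) / (1 - η) with hθ
  have hθ' : θ * (1 - η) = 1 - 1 / r := div_mul_cancel₀ _ hη1.ne'
  have hθ0 : 0 ≤ θ := div_nonneg (by linarith) hη1.le
  have hθ1 : θ ≤ 1 := (div_le_one hη1).2 (by linarith)
  have e1 : t * θ + t * η * (1 - θ) = 1 := by
    have : t * θ + t * η * (1 - θ) = t * (θ * (1 - η) + η) := by ring
    rw [this, hθ', hη]
    field_simp
    ring
  have e2 : r * η * θ + r * (1 - θ) = 1 := by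
    have : r * η * θ + r * (1 - θ) = r * (1 - θ * (1 - η)) := by ring
    rw [this, hθ']
    field_simp
    ring
  obtain ⟨C, hC0, hC⟩ := exists_bilinear_bound hs hN hb hm hr0 ht0 hη0 (by linarith) hθ0 hθ1 e1 e2
  choose U hU using fun n => exists_isEnergySol hs hN hb hm (memLp_clip hb hfi.1 n 2)
  have hcabs : ∀ n, MemLp (fun x => |clip n (f x)|) 2 (volume.restrict Ω) := fun n =>
    (memLp_clip hb hfi.1 n 2).abs
  choose V hV using fun n => exists_isEnergySol hs hN hb hm (hcabs n)
  obtain ⟨w, hw, ns, hns, hlim⟩ := exists_isL1WeakSol_of_tendsto hs hN hb hm hfi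
    (fun n => memLp_clip hb hfi.1 n 2) hU (tendsto_integral_abs_clip_sub hfi)
  have huw := hu.ae_eq hs hN hb ho hw
  set B := C * ((∫ x in Ω, |g x| ^ t) * ((∫ x in Ω, |f x| ^ r) ^ η + 1) +
    (∫ x in Ω, |f x| ^ r) * ((∫ x in Ω, |g x| ^ t) ^ η + 1)) with hB
  have hUV : ∀ n, ∀ᵐ x, |U n x| ≤ V n x := by
    intro n
    filter_upwards [((hV n).add_const_mul hs 1 (hcabs n) (memLp_clip hb hfi.1 n 2)
        (hU n)).nonneg hs hN hb hm fun x => by linarith [neg_abs_le (clip n (f x))],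
      ((hV n).add_const_mul hs (-1) (hcabs n) (memLp_clip hb hfi.1 n 2)
        (hU n)).nonneg hs hN hb hm fun x => by linarith [le_abs_self (clip n (f x))]]
      with x h1 h2
    exact abs_le.2 ⟨by linarith, by linarith⟩
  have hpowle : ∀ (f : Eu N → ℝ) (r : ℝ) (n : ℕ), 0 < r →
      IntegrableOn (fun x => |f x| ^ r) Ω →
      ∫ x in Ω, |clip n (f x)| ^ r ≤ ∫ x in Ω, |f x| ^ r := by
    intro f r n hr hf
    refine integral_mono_of_nonneg (Filter.Eventually.of_forall fun x => by positivity) hf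
      (Filter.Eventually.of_forall fun x => ?_)
    exact Real.rpow_le_rpow (abs_nonneg _) (abs_clip_le_abs n _) hr.le
  have hbound : ∀ n, ∫⁻ x in Ω, ‖clip n (g x) * U n x‖ₑ ≤ ENNReal.ofReal B := by
    intro n
    have h1 := hC (fun x => |clip n (f x)|) (fun x => |clip n (g x)|) (V n) n _ _
      (hcabs n).1 (memLp_clip hb hgm n 2).abs.1 (fun x => abs_nonneg _) (fun x => abs_nonneg _)
      (fun x => abs_clip_le n _) (fun x => abs_clip_le n _) (hV n)
      (hpowle f r n hr0 hf) (hpowle g t n ht0 hg)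
    have hi : Integrable (fun x => |clip n (g x)| * V n x) (volume.restrict Ω) :=
      (memLp_clip hb hgm n 2).abs.integrable_mul ((hV n).memX0.memLp.restrict Ω)
    refine le_trans ?_ (ENNReal.ofReal_le_ofReal h1)
    have hnn : ∀ᵐ x ∂(volume.restrict Ω), 0 ≤ |clip n (g x)| * V n x := by
      filter_upwards [ae_restrict_of_ae (hUV n)] with x hx
      exact mul_nonneg (abs_nonneg _) ((abs_nonneg _).trans hx)
    rw [ofReal_integral_eq_lintegral_ofReal hi hnn]
    refine lintegral_mono_ae ?_
    filter_upwards [ae_restrict_of_ae (hUV n)] with x hx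
    rw [← ofReal_norm, norm_mul, Real.norm_eq_abs, Real.norm_eq_abs]
    exact ENNReal.ofReal_le_ofReal (mul_le_mul_of_nonneg_left hx (abs_nonneg _))
  refine ⟨hgm.mul hu.integrable_sol.1, ?_⟩
  have hae : ∀ᵐ x ∂(volume.restrict Ω), Filter.Tendsto
      (fun k => clip (ns k) (g x) * U (ns k) x) Filter.atTop (nhds (g x * u x)) := by
    filter_upwards [hlim, huw] with x h1 h2
    rw [h2]
    refine Filter.Tendsto.mul ?_ h1
    refine tendsto_const_nhds.congr' ?_
    filter_upwards [hns.tendsto_atTop.eventually (eventually_clip_eq (g x))] with k hk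
    exact hk.symm
  have hfatou : ∫⁻ x in Ω, ‖g x * u x‖ₑ ≤
      Filter.liminf (fun k => ∫⁻ x in Ω, ‖clip (ns k) (g x) * U (ns k) x‖ₑ) Filter.atTop := by
    refine le_trans (le_of_eq (lintegral_congr_ae ?_)) (lintegral_liminf_le' fun k =>
      ((memLp_clip hb hgm (ns k) 2).1.mul
        ((hU (ns k)).memX0.memLp.restrict Ω).1).aemeasurable.enorm)
    filter_upwards [hae] with x hx
    exact hx.enorm.liminf_eq.symm
  change ∫⁻ x in Ω, ‖g x * u x‖ₑ < ⊤
  refine (hfatou.trans (Filter.liminf_le_of_frequently_le' (x := ENNReal.ofReal B)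
    (Filter.Frequently.of_forall fun k => hbound (ns k)))).trans_lt ENNReal.ofReal_lt_top

end

section

/-! ### The Hamiltonian and its Legendre transform -/

theorem fderiv_apply_eq_partial (F : ℝ × ℝ → ℝ) (z ξ : ℝ × ℝ) :
    fderiv ℝ F z ξ = partialU F z * ξ.1 + partialV F z * ξ.2 := by
  have h : ξ = ξ.1 • ((1, 0) : ℝ × ℝ) + ξ.2 • ((0, 1) : ℝ × ℝ) := by ext <;> simp
  conv_lhs => rw [h]
  rw [map_add, map_smul, map_smul, smul_eq_mul, smul_eq_mul, partialU, partialV]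
  ring

/-- A function with monotone gradient lies above its tangent planes. -/
theorem StrictMonoGradient.tangent_le {H : ℝ × ℝ → ℝ} (hmono : StrictMonoGradient H)
    (hH : Differentiable ℝ H) (w z : ℝ × ℝ) :
    H w + (partialU H w * (z.1 - w.1) + partialV H w * (z.2 - w.2)) ≤ H z := by
  rcases eq_or_ne z w with rfl | hne
  · simp
  set ξ := z - w with hξ
  set κ := partialU H w * ξ.1 + partialV H w * ξ.2 with hκ
  have hd : ∀ t : ℝ, HasDerivAt (fun t : ℝ => H (w + t • ξ) - t * κ)
      (fderiv ℝ H (w + t • ξ) ξ - κ) t := by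
    intro t
    have h1 : HasDerivAt (fun t : ℝ => w + t • ξ) ξ t := by
      simpa using ((hasDerivAt_id t).smul_const ξ).const_add w
    exact ((hH _).hasFDerivAt.comp_hasDerivAt t h1).sub
      (by simpa using (hasDerivAt_id t).mul_const κ)
  have hm : MonotoneOn (fun t : ℝ => H (w + t • ξ) - t * κ) (Set.Icc 0 1) := by
    refine monotoneOn_of_deriv_nonneg (convex_Icc 0 1)
      (fun t _ => (hd t).continuousAt.continuousWithinAt)
      (fun t _ => (hd t).differentiableAt.differentiableWithinAt) fun t ht => ?_
    rw [interior_Icc] at ht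
    rw [(hd t).deriv, fderiv_apply_eq_partial]
    have hξ0 : ξ ≠ 0 := sub_ne_zero.2 hne
    have h2 := hmono (w + t • ξ) w (by simp [hξ0, ht.1.ne'])
    simp only [Prod.fst_add, Prod.snd_add, Prod.smul_fst, Prod.smul_snd, smul_eq_mul,
      add_sub_cancel_left] at h2
    have h3 : 0 < t * (partialU H (w + t • ξ) * ξ.1 + partialV H (w + t • ξ) * ξ.2 - κ) := by
      rw [hκ]
      linarith
    exact (pos_of_mul_pos_right h3 ht.1.le).le
  have h := hm (Set.left_mem_Icc.2 zero_le_one) (Set.right_mem_Icc.2 zero_le_one) zero_le_one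
  simp only [zero_smul, add_zero, zero_mul, sub_zero, one_smul, one_mul, hξ,
    add_sub_cancel] at h
  have : κ = partialU H w * (z.1 - w.1) + partialV H w * (z.2 - w.2) := rfl
  linarith

theorem rpow_le_of_mul_rpow_add_one_le {C p a u : ℝ} (hC : 0 < C) (hp : 0 < p)
    (h : C * |u| ^ (p + 1) ≤ a * u) : |u| ^ p ≤ |a| / C := by
  rcases eq_or_ne u 0 with rfl | hu
  · rw [abs_zero, Real.zero_rpow hp.ne']
    positivity
  · have hu' := abs_pos.2 hu
    rw [Real.rpow_add_one hu'.ne', ← mul_assoc] at h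
    have h2 : C * |u| ^ p * |u| ≤ |a| * |u| := h.trans ((le_abs_self _).trans_eq (abs_mul _ _))
    rw [le_div_iff₀ hC, mul_comm]
    exact le_of_mul_le_mul_right h2 hu'

theorem exists_linear_le_rpow {C p : ℝ} (hC : 0 < C) (hp : 0 < p) (L : ℝ) (hL : 0 ≤ L) :
    ∃ K : ℝ, ∀ t : ℝ, 0 ≤ t → L * t - K ≤ C * t ^ (p + 1) := by
  set T := (L / C) ^ (1 / p) with hT
  have hT0 : 0 ≤ T := by positivity
  refine ⟨L * T, fun t ht => ?_⟩
  have h0 : 0 ≤ C * t ^ (p + 1) := by positivity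
  rcases le_total t T with h | h
  · nlinarith
  · rcases ht.eq_or_lt with rfl | ht'
    · nlinarith
    have h1 : L / C ≤ t ^ p := by
      calc L / C = T ^ p := by
            rw [hT, ← Real.rpow_mul (by positivity), one_div_mul_cancel hp.ne', Real.rpow_one]
        _ ≤ t ^ p := Real.rpow_le_rpow hT0 h hp.le
    rw [div_le_iff₀ hC] at h1
    rw [Real.rpow_add_one ht'.ne', ← mul_assoc]
    nlinarith [mul_nonneg hL hT0]

theorem rpow_mul_rpow_le_add {a b α β p q : ℝ} (ha : 0 ≤ a) (hb : 0 ≤ b) (hp : 0 < p)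
    (hq : 0 < q) (hα : 0 < α) (hβ : 0 < β) (h : α / p + β / q = 1) :
    a ^ α * b ^ β ≤ a ^ p + b ^ q := by
  have hα1 : 0 ≤ α / p := by positivity
  have hβ1 : 0 ≤ β / q := by positivity
  have h1 := Real.geom_mean_le_arith_mean2_weighted hα1 hβ1
    (Real.rpow_nonneg ha p) (Real.rpow_nonneg hb q) h
  rw [← Real.rpow_mul ha, ← Real.rpow_mul hb, mul_div_cancel₀ _ hp.ne',
    mul_div_cancel₀ _ hq.ne'] at h1
  have h2 : α / p * a ^ p ≤ 1 * a ^ p :=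
    mul_le_mul_of_nonneg_right (by linarith) (by positivity)
  have h3 : β / q * b ^ q ≤ 1 * b ^ q :=
    mul_le_mul_of_nonneg_right (by linarith) (by positivity)
  linarith

theorem le_one_add_rpow {t p : ℝ} (ht : 0 ≤ t) (hp : 0 ≤ p) : t ≤ 1 + t ^ (p + 1) := by
  rcases le_total t 1 with h | h
  · linarith [Real.rpow_nonneg ht (p + 1)]
  · have := Real.rpow_le_rpow_of_exponent_le h (by linarith : 1 ≤ p + 1)
    rw [Real.rpow_one] at this
    linarith

variable {p q : ℝ} {H : ℝ × ℝ → ℝ}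

theorem exists_abs_le_rpow (hp : 0 < p) (hq : 0 < q) (hH : Differentiable ℝ H)
    (hgrowth : GrowthCondition p q H) (hmono : StrictMonoGradient H) :
    ∃ C : ℝ, ∀ w : ℝ × ℝ, |H w| ≤ C * (1 + |w.1| ^ (p + 1) + |w.2| ^ (q + 1)) := by
  obtain ⟨C₁, C₂, α, β, hC₁, hC₂, hα, hβ, hαβ, hg⟩ := hgrowth
  refine ⟨|H 0| + |partialU H 0| + |partialV H 0| + 3 * C₂, fun w => ?_⟩
  set A := |w.1| ^ (p + 1) with hA
  set B := |w.2| ^ (q + 1) with hB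
  have hA0 : 0 ≤ A := by positivity
  have hB0 : 0 ≤ B := by positivity
  obtain ⟨-, g2, -, g4⟩ := hg w.1 w.2
  have hy : |w.1| ^ α * |w.2| ^ β ≤ A + B :=
    rpow_mul_rpow_le_add (abs_nonneg _) (abs_nonneg _) (by linarith) (by linarith)
      (by linarith) (by linarith) hαβ
  have t1 := hmono.tangent_le hH w 0
  have t2 := hmono.tangent_le hH 0 w
  simp only [Prod.fst_zero, Prod.snd_zero, zero_sub, sub_zero] at t1 t2
  have l1 : |w.1| ≤ 1 + A := le_one_add_rpow (abs_nonneg _) hp.le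
  have l2 : |w.2| ≤ 1 + B := le_one_add_rpow (abs_nonneg _) hq.le
  have m0 := le_abs_self (H 0)
  have m0' := neg_abs_le (H 0)
  have m1 := neg_abs_le (partialU H 0 * w.1)
  have m2 := neg_abs_le (partialV H 0 * w.2)
  rw [abs_mul] at m1 m2
  have a1 := abs_nonneg (H 0)
  have a2 := abs_nonneg (partialU H 0)
  have a3 := abs_nonneg (partialV H 0)
  have n1 := mul_le_mul_of_nonneg_left l1 a2
  have n2 := mul_le_mul_of_nonneg_left l2 a3
  have hy' := mul_le_mul_of_nonneg_left hy hC₂.le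
  rw [abs_le]
  constructor <;>
  nlinarith [mul_nonneg a1 hA0, mul_nonneg a1 hB0, mul_nonneg a2 hA0, mul_nonneg a2 hB0,
    mul_nonneg a3 hA0, mul_nonneg a3 hB0, mul_nonneg hC₂.le hA0, mul_nonneg hC₂.le hB0]

theorem exists_gradient_eq (hp : 0 < p) (hq : 0 < q) (hH : Differentiable ℝ H)
    (hgrowth : GrowthCondition p q H) (hmono : StrictMonoGradient H) (x : ℝ × ℝ) :
    ∃ w, (partialU H w, partialV H w) = x := by
  obtain ⟨C₁, C₂, α, β, hC₁, -, -, -, -, hg⟩ := hgrowth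
  set F : ℝ × ℝ → ℝ := fun w => H w - (w.1 * x.1 + w.2 * x.2) with hF
  set L₁ := |2 * x.1 - partialU H 0| + 1 with hL₁
  set L₂ := |2 * x.2 - partialV H 0| + 1 with hL₂
  obtain ⟨K₁, hK₁⟩ := exists_linear_le_rpow hC₁ hp L₁ (by positivity)
  obtain ⟨K₂, hK₂⟩ := exists_linear_le_rpow hC₁ hq L₂ (by positivity)
  have hlow : ∀ y : ℝ × ℝ, F 0 + (|y.1| + |y.2| - (K₁ + K₂)) ≤ F ((2 : ℝ) • y) := by
    intro y
    have t1 := hmono.tangent_le hH y ((2 : ℝ) • y)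
    have t2 := hmono.tangent_le hH 0 y
    obtain ⟨g1, -, g3, -⟩ := hg y.1 y.2
    have k1 := hK₁ _ (abs_nonneg y.1)
    have k2 := hK₂ _ (abs_nonneg y.2)
    have a1 := le_abs_self ((2 * x.1 - partialU H 0) * y.1)
    have a2 := le_abs_self ((2 * x.2 - partialV H 0) * y.2)
    rw [abs_mul] at a1 a2
    simp only [hF, Prod.fst_zero, Prod.snd_zero, sub_zero, Prod.smul_fst, Prod.smul_snd,
      smul_eq_mul, hL₁, hL₂, Prod.mk.eta] at *
    linarith
  have hcont : Continuous F := by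
    have := hH.continuous
    fun_prop
  obtain ⟨w, hw⟩ := hcont.exists_forall_le' 0 (by
    have := tendsto_norm_cocompact_atTop (E := ℝ × ℝ)
    filter_upwards [this.eventually_ge_atTop (2 * (K₁ + K₂))] with z hz
    have h1 := hlow ((1 / 2 : ℝ) • z)
    rw [smul_smul, mul_one_div_cancel two_ne_zero, one_smul] at h1
    have h2 : ‖z‖ ≤ |z.1| + |z.2| := by
      rw [Prod.norm_def]
      exact max_le (by simp) (by simp)
    simp only [Prod.smul_fst, Prod.smul_snd, smul_eq_mul, abs_mul] at h1
    rw [abs_of_pos (by norm_num : (0 : ℝ) < 1 / 2)] at h1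
    linarith)
  have hd : HasFDerivAt F (fderiv ℝ H w -
      (x.1 • ContinuousLinearMap.fst ℝ ℝ ℝ + x.2 • ContinuousLinearMap.snd ℝ ℝ ℝ)) w := by
    refine (hH w).hasFDerivAt.sub ?_
    exact (hasFDerivAt_fst.mul_const x.1).add (hasFDerivAt_snd.mul_const x.2)
  have h0 := (IsLocalMin.hasFDerivAt_eq_zero (Filter.Eventually.of_forall hw) hd)
  refine ⟨w, ?_⟩
  have e1 := congrArg (fun T : ℝ × ℝ →L[ℝ] ℝ => T (1, 0)) h0
  have e2 := congrArg (fun T : ℝ × ℝ →L[ℝ] ℝ => T (0, 1)) h0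
  simp at e1 e2
  ext
  · exact sub_eq_zero.1 e1
  · exact sub_eq_zero.1 e2

/-- `∇H` is a homeomorphism of the plane. -/
theorem exists_gradient_homeomorph (hp : 0 < p) (hq : 0 < q) (hH : ContDiff ℝ 1 H)
    (hgrowth : GrowthCondition p q H) (hmono : StrictMonoGradient H) :
    ∃ e : (ℝ × ℝ) ≃ₜ (ℝ × ℝ), ∀ w, e w = (partialU H w, partialV H w) := by
  set G : ℝ × ℝ → ℝ × ℝ := fun w => (partialU H w, partialV H w) with hG
  have hcont : Continuous G := by
    have h := hH.continuous_fderiv one_ne_zero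
    exact (h.clm_apply continuous_const).prodMk (h.clm_apply continuous_const)
  have hbij : Function.Bijective G := by
    refine ⟨fun z w h => ?_,
      exists_gradient_eq hp hq (hH.differentiable one_ne_zero) hgrowth hmono⟩
    by_contra hne
    have h1 := hmono z w hne
    obtain ⟨e1, e2⟩ := Prod.mk.inj h
    rw [e1, e2] at h1
    simp at h1
  obtain ⟨C₁, C₂, α, β, hC₁, -, -, -, -, hg⟩ := hgrowth
  have hproper : IsProperMap G := by
    refine isProperMap_iff_isCompact_preimage.2 ⟨hcont, fun K hK => ?_⟩
    obtain ⟨R, hR⟩ := hK.isBounded.subset_closedBall (0 : ℝ × ℝ)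
    refine Metric.isCompact_of_isClosed_isBounded (hK.isClosed.preimage hcont) ?_
    refine (Metric.isBounded_closedBall (x := (0 : ℝ × ℝ))
      (r := max ((R / C₁) ^ (1 / p)) ((R / C₁) ^ (1 / q)))).subset fun w hw => ?_
    have h1 : ‖G w‖ ≤ R := by simpa using hR hw
    obtain ⟨g1, -, g3, -⟩ := hg w.1 w.2
    have key : ∀ {r a u : ℝ}, 0 < r → |a| ≤ R → C₁ * |u| ^ (r + 1) ≤ a * u →
        |u| ≤ (R / C₁) ^ (1 / r) := by
      intro r a u hr ha h
      have h2 := (rpow_le_of_mul_rpow_add_one_le hC₁ hr h).trans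
        (div_le_div_of_nonneg_right ha hC₁.le)
      rw [one_div]
      exact (Real.le_rpow_inv_iff_of_pos (abs_nonneg _)
        (by have := (abs_nonneg a).trans ha; positivity) hr).2 h2
    rw [mem_closedBall_zero_iff, Prod.norm_def]
    exact max_le_max (key hp ((norm_fst_le (G w)).trans h1) g1)
      (key hq ((norm_snd_le (G w)).trans h1) g3)
  exact ⟨(Equiv.ofBijective G hbij).toHomeomorphOfContinuousClosed hcont hproper.isClosedMap,
    fun w => rfl⟩

/-- The Fenchel-Young inequality. -/
theorem StrictMonoGradient.fenchel_young (hmono : StrictMonoGradient H)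
    (hH : Differentiable ℝ H) (w w' : ℝ × ℝ) :
    w'.1 * partialU H w + w'.2 * partialV H w - H w' ≤
      w.1 * partialU H w + w.2 * partialV H w - H w := by
  have := hmono.tangent_le hH w w'
  linarith

theorem legendre_gradient (hmono : StrictMonoGradient H) (hH : Differentiable ℝ H)
    (w : ℝ × ℝ) : legendre H (partialU H w, partialV H w) =
      w.1 * partialU H w + w.2 * partialV H w - H w :=
  le_antisymm (ciSup_le fun w' => hmono.fenchel_young hH w w')
    (le_ciSup (f := fun w' : ℝ × ℝ => w'.1 * partialU H w + w'.2 * partialV H w - H w')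
      ⟨_, Set.forall_mem_range.2 fun w' => hmono.fenchel_young hH w w'⟩ w)

theorem partialU_symm {e : (ℝ × ℝ) ≃ₜ (ℝ × ℝ)} (he : ∀ w, e w = (partialU H w, partialV H w))
    (x : ℝ × ℝ) : partialU H (e.symm x) = x.1 := by
  have h := congrArg Prod.fst (he (e.symm x))
  rw [e.apply_symm_apply] at h
  exact h.symm

theorem partialV_symm {e : (ℝ × ℝ) ≃ₜ (ℝ × ℝ)} (he : ∀ w, e w = (partialU H w, partialV H w))
    (x : ℝ × ℝ) : partialV H (e.symm x) = x.2 := by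
  have h := congrArg Prod.snd (he (e.symm x))
  rw [e.apply_symm_apply] at h
  exact h.symm

/-- The gradient of the Legendre transform inverts the gradient. -/
theorem hasFDerivAt_legendre (hmono : StrictMonoGradient H) (hH : Differentiable ℝ H)
    {e : (ℝ × ℝ) ≃ₜ (ℝ × ℝ)} (he : ∀ w, e w = (partialU H w, partialV H w)) (x : ℝ × ℝ) :
    HasFDerivAt (legendre H) ((e.symm x).1 • ContinuousLinearMap.fst ℝ ℝ ℝ +
      (e.symm x).2 • ContinuousLinearMap.snd ℝ ℝ ℝ) x := by
  have hval : ∀ y, legendre H y =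
      (e.symm y).1 * y.1 + (e.symm y).2 * y.2 - H (e.symm y) := by
    intro y
    have h := legendre_gradient hmono hH (e.symm y)
    rwa [partialU_symm he, partialV_symm he] at h
  have hfy : ∀ y w, w.1 * y.1 + w.2 * y.2 - H w ≤
      (e.symm y).1 * y.1 + (e.symm y).2 * y.2 - H (e.symm y) := by
    intro y w
    have h := hmono.fenchel_young hH (e.symm y) w
    rwa [partialU_symm he, partialV_symm he] at h
  rw [hasFDerivAt_iff_isLittleO, Asymptotics.isLittleO_iff]
  intro c hc
  have hcont : Filter.Tendsto (fun y => e.symm y - e.symm x) (nhds x) (nhds 0) := by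
    have := (e.symm.continuous.tendsto x).sub_const (e.symm x)
    rwa [sub_self] at this
  filter_upwards [hcont.norm.eventually (gt_mem_nhds
    (by simpa using half_pos hc : ‖(0 : ℝ × ℝ)‖ < c / 2))] with y hy
  have h1 := hfy y (e.symm x)
  have h2 := hfy x (e.symm y)
  have b1 := norm_fst_le (e.symm y - e.symm x)
  have b2 := norm_snd_le (e.symm y - e.symm x)
  have c1 := norm_fst_le (y - x)
  have c2 := norm_snd_le (y - x)
  have d1 : ((e.symm y).1 - (e.symm x).1) * (y.1 - x.1) ≤ c / 2 * ‖y - x‖ := by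
    refine (le_abs_self _).trans ?_
    rw [abs_mul]
    exact mul_le_mul (b1.trans hy.le) c1 (abs_nonneg _) (by positivity)
  have d2 : ((e.symm y).2 - (e.symm x).2) * (y.2 - x.2) ≤ c / 2 * ‖y - x‖ := by
    refine (le_abs_self _).trans ?_
    rw [abs_mul]
    exact mul_le_mul (b2.trans hy.le) c2 (abs_nonneg _) (by positivity)
  have e1 : legendre H y - legendre H x - ((e.symm x).1 • ContinuousLinearMap.fst ℝ ℝ ℝ +
      (e.symm x).2 • ContinuousLinearMap.snd ℝ ℝ ℝ) (y - x) =
      legendre H y - legendre H x -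
        ((e.symm x).1 * (y.1 - x.1) + (e.symm x).2 * (y.2 - x.2)) := by
    simp
  rw [e1, hval, hval, Real.norm_eq_abs, abs_le]
  have := mul_nonneg hc.le (norm_nonneg (y - x))
  constructor <;> linarith

theorem partial_legendre (hmono : StrictMonoGradient H) (hH : Differentiable ℝ H)
    {e : (ℝ × ℝ) ≃ₜ (ℝ × ℝ)} (he : ∀ w, e w = (partialU H w, partialV H w)) (x : ℝ × ℝ) :
    (partialU (legendre H) x, partialV (legendre H) x) = e.symm x := by
  have h := (hasFDerivAt_legendre hmono hH he x).fderiv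
  ext <;> simp [partialU, partialV, h]

end

section

/-! ### The dual functional at a critical point -/

theorem memLp_one_add_ofReal_iff {α : Type*} [MeasurableSpace α] {μ : Measure α} {f : α → ℝ}
    {a : ℝ} (ha : 0 ≤ a) (hf : AEStronglyMeasurable f μ) :
    MemLp f (1 + ENNReal.ofReal a) μ ↔ Integrable (fun x => |f x| ^ (a + 1)) μ := by
  have h : (1 + ENNReal.ofReal a).toReal = a + 1 := by
    rw [ENNReal.toReal_add ENNReal.one_ne_top ENNReal.ofReal_ne_top, ENNReal.toReal_ofReal ha,
      ENNReal.toReal_one, add_comm]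
  rw [← h]
  exact (integrable_norm_rpow_iff hf (by simp) (by simp)).symm

theorem MemLp.integrable_mul_of_conj {α : Type*} [MeasurableSpace α] {μ : Measure α}
    {f u : α → ℝ} {p : ℝ} (hp : 0 < p) (hf : MemLp f (1 + ENNReal.ofReal (1 / p)) μ)
    (hu : MemLp u (1 + ENNReal.ofReal p) μ) : Integrable (fun x => f x * u x) μ := by
  refine (((memLp_one_add_ofReal_iff (by positivity) hf.1).1 hf).add
    ((memLp_one_add_ofReal_iff hp.le hu.1).1 hu)).mono' (hf.1.mul hu.1)
    (Filter.Eventually.of_forall fun x => ?_)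
  have := rpow_mul_rpow_le_add (abs_nonneg (f x)) (abs_nonneg (u x))
    (by positivity : 0 < 1 / p + 1) (by positivity : 0 < p + 1) one_pos one_pos
    (by field_simp; ring)
  simpa only [Real.rpow_one, Real.norm_eq_abs, abs_mul, Pi.add_apply] using this

theorem memLp_of_abs_rpow_le {α : Type*} [MeasurableSpace α] {μ : Measure α}
    {f u : α → ℝ} {p C : ℝ} (hp : 0 < p) (hC : 0 < C) (hu : AEStronglyMeasurable u μ)
    (h : ∀ x, |u x| ^ p ≤ |f x| / C) (hf : MemLp f (1 + ENNReal.ofReal (1 / p)) μ) :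
    MemLp u (1 + ENNReal.ofReal p) μ := by
  rw [memLp_one_add_ofReal_iff hp.le hu]
  refine (((memLp_one_add_ofReal_iff (by positivity) hf.1).1 hf).div_const
    (C ^ (1 / p + 1))).mono' ?_ (Filter.Eventually.of_forall fun x => ?_)
  · exact (hu.aemeasurable.abs.pow_const _).aestronglyMeasurable
  · rw [Real.norm_of_nonneg (by positivity), ← Real.div_rpow (abs_nonneg _) hC.le]
    calc |u x| ^ (p + 1) = (|u x| ^ p) ^ (1 / p + 1) := by
          rw [← Real.rpow_mul (abs_nonneg _)]
          congr 1
          field_simp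
          ring
      _ ≤ _ := Real.rpow_le_rpow (by positivity) (h x) (by positivity)

/-- At a critical point of `S - B`, a subgradient of `S` and the derivative of `B` along a line
agree. -/
theorem eq_of_isCriticalPoint {V : Type*} [NormedAddCommGroup V] [NormedSpace ℝ V]
    {S B : V → ℝ} {z ζ : V} {a b : ℝ} (hz : IsCriticalPoint (fun z => S z - B z) z)
    (hS : ∀ t : ℝ, S z + t * a ≤ S (z + t • ζ)) (hB : ∀ t : ℝ, B (z + t • ζ) = B z + t * b) :
    a = b := by
  have h1 : HasDerivAt (fun t : ℝ => z + t • ζ) ζ 0 := by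
    simpa using ((hasDerivAt_id (0 : ℝ)).smul_const ζ).const_add z
  have hz' : HasFDerivAt (fun z => S z - B z) (0 : V →L[ℝ] ℝ) (z + (0 : ℝ) • ζ) := by
    rw [zero_smul, add_zero]
    exact hz
  have h2 := (hz'.comp_hasDerivAt (0 : ℝ) h1).sub ((hasDerivAt_id (0 : ℝ)).mul_const (a - b))
  have h3 : IsLocalMin (fun t : ℝ => S (z + t • ζ) - B (z + t • ζ) - t * (a - b)) 0 := by
    refine Filter.Eventually.of_forall fun t => ?_
    have := hS t
    simp only [hB, zero_smul, add_zero, zero_mul, sub_zero]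
    linarith
  have h4 := h3.hasDerivAt_eq_zero h2
  simp only [zero_apply, one_mul] at h4
  linarith

variable {N : ℕ} {s : ℝ} {Ω : Set (Eu N)} {p q : ℝ} {H : ℝ × ℝ → ℝ}

theorem integrable_comp_of_memLp (hb : Bornology.IsBounded Ω) (hp : 0 < p) (hq : 0 < q)
    (hH : Differentiable ℝ H) (hgrowth : GrowthCondition p q H) (hmono : StrictMonoGradient H)
    {u v : Eu N → ℝ} (hu : MemLp u (1 + ENNReal.ofReal p) (volume.restrict Ω))
    (hv : MemLp v (1 + ENNReal.ofReal q) (volume.restrict Ω)) :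
    IntegrableOn (fun x => H (u x, v x)) Ω := by
  have : IsFiniteMeasure (volume.restrict Ω) := isFiniteMeasure_restrict.2 hb.measure_lt_top.ne
  obtain ⟨C, hC⟩ := exists_abs_le_rpow hp hq hH hgrowth hmono
  exact (((integrable_const 1).add ((memLp_one_add_ofReal_iff hp.le hu.1).1 hu)).add
    ((memLp_one_add_ofReal_iff hq.le hv.1).1 hv) |>.const_mul C).mono'
    (hH.continuous.comp_aestronglyMeasurable (hu.1.prodMk hv.1))
    (Filter.Eventually.of_forall fun x => hC (u x, v x))

section Maximizer

variable {e : (ℝ × ℝ) ≃ₜ (ℝ × ℝ)}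

theorem memLp_gradient_symm (hp : 0 < p) (hq : 0 < q) (hgrowth : GrowthCondition p q H)
    (he : ∀ w, e w = (partialU H w, partialV H w)) (z : SpaceX Ω p q) :
    MemLp (fun x => (e.symm (z.1 x, z.2 x)).1) (1 + ENNReal.ofReal p) (volume.restrict Ω) ∧
    MemLp (fun x => (e.symm (z.1 x, z.2 x)).2) (1 + ENNReal.ofReal q) (volume.restrict Ω) := by
  obtain ⟨C₁, C₂, α, β, hC₁, -, -, -, -, hg⟩ := hgrowth
  have hm := e.symm.continuous.comp_aestronglyMeasurable
    ((Lp.memLp z.1).1.prodMk (Lp.memLp z.2).1)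
  refine ⟨memLp_of_abs_rpow_le hp hC₁ (continuous_fst.comp_aestronglyMeasurable hm)
    (fun x => rpow_le_of_mul_rpow_add_one_le hC₁ hp ?_) (Lp.memLp z.1),
    memLp_of_abs_rpow_le hq hC₁ (continuous_snd.comp_aestronglyMeasurable hm)
    (fun x => rpow_le_of_mul_rpow_add_one_le hC₁ hq ?_) (Lp.memLp z.2)⟩
  · have := (hg (e.symm (z.1 x, z.2 x)).1 (e.symm (z.1 x, z.2 x)).2).1
    rwa [Prod.mk.eta, partialU_symm he] at this
  · have := (hg (e.symm (z.1 x, z.2 x)).1 (e.symm (z.1 x, z.2 x)).2).2.2.1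
    rwa [Prod.mk.eta, partialV_symm he] at this

/-- The supremum defining `ℋ^*(z)` is attained at `∇H^*(z)`. -/
theorem isGreatest_hamFunctionalStar (hb : Bornology.IsBounded Ω) (hp : 0 < p) (hq : 0 < q)
    (hH : Differentiable ℝ H) (hgrowth : GrowthCondition p q H) (hmono : StrictMonoGradient H)
    (he : ∀ w, e w = (partialU H w, partialV H w)) (z : SpaceX Ω p q) :
    ∃ W : SpaceXDual Ω p q, (W.1 =ᵐ[volume.restrict Ω] fun x => (e.symm (z.1 x, z.2 x)).1) ∧
      (W.2 =ᵐ[volume.restrict Ω] fun x => (e.symm (z.1 x, z.2 x)).2) ∧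
      ∀ w : SpaceXDual Ω p q,
        (∫ x in Ω, (z.1 x * w.1 x + z.2 x * w.2 x)) - hamFunctional Ω p q H w ≤
        (∫ x in Ω, (z.1 x * W.1 x + z.2 x * W.2 x)) - hamFunctional Ω p q H W := by
  obtain ⟨hu, hv⟩ := memLp_gradient_symm hp hq hgrowth he z
  refine ⟨(hu.toLp _, hv.toLp _), hu.coeFn_toLp, hv.coeFn_toLp, fun w => ?_⟩
  have i1 : ∀ w : SpaceXDual Ω p q, Integrable (fun x => z.1 x * w.1 x + z.2 x * w.2 x)
      (volume.restrict Ω) := fun w =>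
    (MemLp.integrable_mul_of_conj hp (Lp.memLp z.1) (Lp.memLp w.1)).add
      (MemLp.integrable_mul_of_conj hq (Lp.memLp z.2) (Lp.memLp w.2))
  have i2 : ∀ w : SpaceXDual Ω p q, Integrable (fun x => H (w.1 x, w.2 x))
      (volume.restrict Ω) := fun w =>
    integrable_comp_of_memLp hb hp hq hH hgrowth hmono (Lp.memLp w.1) (Lp.memLp w.2)
  unfold hamFunctional
  rw [← integral_sub (i1 _) (i2 _), ← integral_sub (i1 _) (i2 _)]
  refine integral_mono_ae ((i1 _).sub (i2 _)) ((i1 _).sub (i2 _)) ?_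
  filter_upwards [hu.coeFn_toLp, hv.coeFn_toLp] with x h1 h2
  have h := hmono.fenchel_young hH (e.symm (z.1 x, z.2 x)) (w.1 x, w.2 x)
  rw [partialU_symm he, partialV_symm he] at h
  simp only [h1, h2, Prod.mk.eta]
  simp only at h
  linarith

/-- `∇H^*(z)` is a subgradient of `ℋ^*` at `z`. -/
theorem hamFunctionalStar_add_ge (hb : Bornology.IsBounded Ω) (hp : 0 < p) (hq : 0 < q)
    (hH : Differentiable ℝ H) (hgrowth : GrowthCondition p q H) (hmono : StrictMonoGradient H)
    (he : ∀ w, e w = (partialU H w, partialV H w)) (z ζ : SpaceX Ω p q) :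
    hamFunctionalStar Ω p q H z + ∫ x in Ω, (ζ.1 x * (e.symm (z.1 x, z.2 x)).1 +
      ζ.2 x * (e.symm (z.1 x, z.2 x)).2) ≤ hamFunctionalStar Ω p q H (z + ζ) := by
  obtain ⟨W, hW1, hW2, hW⟩ := isGreatest_hamFunctionalStar hb hp hq hH hgrowth hmono he z
  obtain ⟨W', -, -, hW'⟩ := isGreatest_hamFunctionalStar hb hp hq hH hgrowth hmono he (z + ζ)
  have h1 : hamFunctionalStar Ω p q H z ≤
      (∫ x in Ω, (z.1 x * W.1 x + z.2 x * W.2 x)) - hamFunctional Ω p q H W := ciSup_le hW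
  have h2 : (∫ x in Ω, ((z + ζ).1 x * W.1 x + (z + ζ).2 x * W.2 x)) - hamFunctional Ω p q H W ≤
      hamFunctionalStar Ω p q H (z + ζ) :=
    le_ciSup (f := fun w : SpaceXDual Ω p q =>
      (∫ x in Ω, ((z + ζ).1 x * w.1 x + (z + ζ).2 x * w.2 x)) - hamFunctional Ω p q H w)
      ⟨_, Set.forall_mem_range.2 hW'⟩ W
  have i1 : ∀ z : SpaceX Ω p q, Integrable (fun x => z.1 x * W.1 x + z.2 x * W.2 x)
      (volume.restrict Ω) := fun z =>
    (MemLp.integrable_mul_of_conj hp (Lp.memLp z.1) (Lp.memLp W.1)).add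
      (MemLp.integrable_mul_of_conj hq (Lp.memLp z.2) (Lp.memLp W.2))
  have h3 : ∫ x in Ω, ((z + ζ).1 x * W.1 x + (z + ζ).2 x * W.2 x) =
      (∫ x in Ω, (z.1 x * W.1 x + z.2 x * W.2 x)) +
      ∫ x in Ω, (ζ.1 x * W.1 x + ζ.2 x * W.2 x) := by
    rw [← integral_add (i1 z) (i1 ζ)]
    refine integral_congr_ae ?_
    filter_upwards [Lp.coeFn_add z.1 ζ.1, Lp.coeFn_add z.2 ζ.2] with x e1 e2
    rw [Prod.fst_add, Prod.snd_add, e1, e2, Pi.add_apply, Pi.add_apply]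
    ring
  have h4 : ∫ x in Ω, (ζ.1 x * W.1 x + ζ.2 x * W.2 x) =
      ∫ x in Ω, (ζ.1 x * (e.symm (z.1 x, z.2 x)).1 + ζ.2 x * (e.symm (z.1 x, z.2 x)).2) := by
    refine integral_congr_ae ?_
    filter_upwards [hW1, hW2] with x e1 e2
    rw [e1, e2]
  linarith

end Maximizer

end

section

variable {N : ℕ} {s : ℝ} {Ω : Set (Eu N)} {p q : ℝ} {H : ℝ × ℝ → ℝ}
  {e : (ℝ × ℝ) ≃ₜ (ℝ × ℝ)}

theorem integrable_coe_Lp_one_add (hb : Bornology.IsBounded Ω) {a : ℝ}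
    (f : Lp ℝ (1 + ENNReal.ofReal a) ((volume : Measure (Eu N)).restrict Ω)) :
    IntegrableOn f Ω := by
  have : IsFiniteMeasure (volume.restrict Ω) := isFiniteMeasure_restrict.2 hb.measure_lt_top.ne
  exact (Lp.memLp f).integrable le_self_add

/-- The derivative of the dual functional in the directions `(h, 0)`. -/
theorem integral_partialU_mul_eq_of_isCriticalPoint (hs : 0 < s) (hN : 2 * s < (N : ℝ))
    (hb : Bornology.IsBounded Ω) (ho : IsOpen Ω) (hp : 0 < p) (hq : 0 < q)
    (hH : Differentiable ℝ H) (hgrowth : GrowthCondition p q H) (hmono : StrictMonoGradient H)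
    (he : ∀ w, e w = (partialU H w, partialV H w)) {z : SpaceX Ω p q}
    (hz : IsCriticalPoint (dualFunctional s Ω p q H) z) {φ h : Eu N → ℝ}
    (hφ : TestFracLap s Ω φ h)
    (hi : IntegrableOn (fun x => z.2 x * invFracLap s Ω z.1 x) Ω) :
    ∫ x in Ω, (e.symm (z.1 x, z.2 x)).1 * h x = ∫ x in Ω, z.2 x * φ x := by
  have hh := hφ.isTestFun.memLp (1 + ENNReal.ofReal (1 / p))
  let ζ : SpaceX Ω p q := (hh.toLp h, 0)
  have hS : ∀ t : ℝ, hamFunctionalStar Ω p q H z +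
      t * ∫ x in Ω, (e.symm (z.1 x, z.2 x)).1 * h x ≤ hamFunctionalStar Ω p q H (z + t • ζ) := by
    intro t
    refine le_trans (le_of_eq ?_)
      (hamFunctionalStar_add_ge hb hp hq hH hgrowth hmono he z (t • ζ))
    rw [← integral_const_mul]
    congr 1
    refine integral_congr_ae ?_
    filter_upwards [Lp.coeFn_smul t (hh.toLp h), hh.coeFn_toLp,
      Lp.coeFn_zero ℝ (1 + ENNReal.ofReal (1 / q)) ((volume : Measure (Eu N)).restrict Ω)]
      with x h1 h2 h3
    simp only [ζ, Prod.smul_fst, Prod.smul_snd, smul_zero, h1, h3, Pi.smul_apply, h2,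
      smul_eq_mul, Pi.zero_apply]
    ring
  have hf := integrable_coe_Lp_one_add hb z.1
  have hA := invFracLap_spec hs hN hb ho.measurableSet hf
  refine eq_of_isCriticalPoint (B := fun z : SpaceX Ω p q =>
    ∫ x in Ω, z.2 x * invFracLap s Ω z.1 x) hz hS fun t => ?_
  have hAt := invFracLap_spec hs hN hb ho.measurableSet
    (integrable_coe_Lp_one_add hb (z + t • ζ).1)
  have hsol := hA.add_const_mul t
    (hφ.isEnergySol.isL1WeakSol hs hN hb ho.measurableSet (hφ.isTestFun.memLp 2))
  have hdata : (fun x => z.1 x + t * h x) =ᵐ[volume.restrict Ω] (z + t • ζ).1 := by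
    filter_upwards [Lp.coeFn_add z.1 (t • hh.toLp h), Lp.coeFn_smul t (hh.toLp h),
      hh.coeFn_toLp] with x h1 h2 h3
    simp only [ζ, Prod.fst_add, Prod.smul_fst, h1, Pi.add_apply, h2, Pi.smul_apply, h3,
      smul_eq_mul]
  have hae := hAt.ae_eq hs hN hb ho (hsol.congr_data hdata)
  have h2 : (z + t • ζ).2 = z.2 := by simp [ζ]
  have hφi := hφ.integrable_mul hs hN hb ho.measurableSet (integrable_coe_Lp_one_add hb z.2)
  rw [← integral_const_mul, ← integral_add hi (hφi.const_mul t)]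
  refine integral_congr_ae ?_
  filter_upwards [hae] with x hx
  simp only [h2, hx]
  ring

/-- The derivative of the dual functional in the directions `(0, h)`. -/
theorem integral_partialV_mul_eq_of_isCriticalPoint (hs : 0 < s) (hN : 2 * s < (N : ℝ))
    (hb : Bornology.IsBounded Ω) (ho : IsOpen Ω) (hp : 0 < p) (hq : 0 < q)
    (hH : Differentiable ℝ H) (hgrowth : GrowthCondition p q H) (hmono : StrictMonoGradient H)
    (he : ∀ w, e w = (partialU H w, partialV H w)) {z : SpaceX Ω p q}
    (hz : IsCriticalPoint (dualFunctional s Ω p q H) z) {h : Eu N → ℝ}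
    (hT : IsTestFun Ω h)
    (hi : IntegrableOn (fun x => z.2 x * invFracLap s Ω z.1 x) Ω) :
    ∫ x in Ω, (e.symm (z.1 x, z.2 x)).2 * h x = ∫ x in Ω, invFracLap s Ω z.1 x * h x := by
  have hh := hT.memLp (1 + ENNReal.ofReal (1 / q))
  let ζ : SpaceX Ω p q := (0, hh.toLp h)
  have hS : ∀ t : ℝ, hamFunctionalStar Ω p q H z +
      t * ∫ x in Ω, (e.symm (z.1 x, z.2 x)).2 * h x ≤ hamFunctionalStar Ω p q H (z + t • ζ) := by
    intro t
    refine le_trans (le_of_eq ?_)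
      (hamFunctionalStar_add_ge hb hp hq hH hgrowth hmono he z (t • ζ))
    rw [← integral_const_mul]
    congr 1
    refine integral_congr_ae ?_
    filter_upwards [Lp.coeFn_smul t (hh.toLp h), hh.coeFn_toLp,
      Lp.coeFn_zero ℝ (1 + ENNReal.ofReal (1 / p)) ((volume : Measure (Eu N)).restrict Ω)]
      with x h1 h2 h3
    simp only [ζ, Prod.smul_fst, Prod.smul_snd, smul_zero, h1, h3, Pi.smul_apply, h2,
      smul_eq_mul, Pi.zero_apply]
    ring
  have hA := invFracLap_spec hs hN hb ho.measurableSet (integrable_coe_Lp_one_add hb z.1)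
  refine eq_of_isCriticalPoint (B := fun z : SpaceX Ω p q =>
    ∫ x in Ω, z.2 x * invFracLap s Ω z.1 x) hz hS fun t => ?_
  have h1 : (z + t • ζ).1 = z.1 := by simp [ζ]
  rw [← integral_const_mul,
    ← integral_add hi ((hT.integrable_mul hA.integrable_sol).const_mul t)]
  refine integral_congr_ae ?_
  filter_upwards [Lp.coeFn_add z.2 (t • hh.toLp h), Lp.coeFn_smul t (hh.toLp h),
    hh.coeFn_toLp] with x h2 h3 h4
  simp only [h1]
  simp only [ζ, Prod.snd_add, Prod.smul_snd, h2, Pi.add_apply, h3, Pi.smul_apply, h4,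
    smul_eq_mul]
  ring

/-- In the subcritical range the quadratic part `∫_Ω g 𝒜 f` of the dual functional converges. -/
theorem integrable_mul_invFracLap (hs : 0 < s) (hN : 2 * s < (N : ℝ))
    (hb : Bornology.IsBounded Ω) (ho : IsOpen Ω) (hp : 0 < p) (hq : 0 < q)
    (hsuper : 1 / (p + 1) + 1 / (q + 1) < 1)
    (hsub : ((N : ℝ) - 2 * s) / N < 1 / (p + 1) + 1 / (q + 1)) (z : SpaceX Ω p q) :
    IntegrableOn (fun x => z.2 x * invFracLap s Ω z.1 x) Ω := by
  have hf := integrable_coe_Lp_one_add hb z.1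
  have hN0 : (N : ℝ) ≠ 0 := by
    have : (0 : ℝ) < N := by linarith
    exact this.ne'
  have hconj : ∀ {p : ℝ}, 0 < p → 1 / (1 / p + 1) = 1 - 1 / (p + 1) := fun {p} hp => by
    field_simp
    ring
  have hp1 : 0 < 1 / p := by positivity
  have hq1 : 0 < 1 / q := by positivity
  rw [sub_div, div_self hN0] at hsub
  refine integrable_mul_isL1WeakSol hs hN hb ho (by linarith : 1 < 1 / p + 1)
    (by linarith : 1 < 1 / q + 1) (by rw [hconj hp, hconj hq]; linarith)
    (by rw [hconj hp, hconj hq]; linarith) hf (Lp.memLp z.2).1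
    ((memLp_one_add_ofReal_iff hp1.le (Lp.memLp z.1).1).1 (Lp.memLp z.1))
    ((memLp_one_add_ofReal_iff hq1.le (Lp.memLp z.2).1).1 (Lp.memLp z.2))
    (invFracLap_spec hs hN hb ho.measurableSet hf)

end

end FracHam

end

theorem mainTheorem7 (N : ℕ) (s : ℝ) (hs0 : 0 < s) (hs1 : s < 1) (hN : 2 * s < (N : ℝ))
    (Ω : Set (FracHam.Eu N)) (hΩ : FracHam.IsSmoothBoundedDomain Ω)
    (p q : ℝ) (hp : 0 < p) (hq : 0 < q)
    (hsuper : 1 / (p + 1) + 1 / (q + 1) < 1)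
    (hsub : ((N : ℝ) - 2 * s) / N < 1 / (p + 1) + 1 / (q + 1))
    (H : ℝ × ℝ → ℝ) (hH : ContDiff ℝ 1 H)
    (hgrowth : FracHam.GrowthCondition p q H)
    (hmono : FracHam.StrictMonoGradient H)
    (z : FracHam.SpaceX Ω p q)
    (hz : FracHam.IsCriticalPoint (FracHam.dualFunctional s Ω p q H) z) :
    FracHam.IsL1WeakSolSystem s Ω H
      (fun x => FracHam.partialU (FracHam.legendre H) (z.1 x, z.2 x))
      (fun x => FracHam.partialV (FracHam.legendre H) (z.1 x, z.2 x)) := by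
  obtain ⟨e, he⟩ := FracHam.exists_gradient_homeomorph hp hq hH hgrowth hmono
  have hH' : Differentiable ℝ H := hH.differentiable one_ne_zero
  have hb := hΩ.isBounded
  have ho := hΩ.isOpen
  have hL := FracHam.partial_legendre hmono hH' he
  have hU : ∀ x, FracHam.partialU (FracHam.legendre H) x = (e.symm x).1 := fun x =>
    congrArg Prod.fst (hL x)
  have hV : ∀ x, FracHam.partialV (FracHam.legendre H) x = (e.symm x).2 := fun x =>
    congrArg Prod.snd (hL x)
  have : IsFiniteMeasure (volume.restrict Ω) := isFiniteMeasure_restrict.2 hb.measure_lt_top.ne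
  obtain ⟨hum, hvm⟩ := FracHam.memLp_gradient_symm hp hq hgrowth he z
  have hui : IntegrableOn (fun x => (e.symm (z.1 x, z.2 x)).1) Ω := hum.integrable le_self_add
  have hvi : IntegrableOn (fun x => (e.symm (z.1 x, z.2 x)).2) Ω := hvm.integrable le_self_add
  have hint := FracHam.integrable_mul_invFracLap hs0 hN hb ho hp hq hsuper hsub z
  have hf := FracHam.integrable_coe_Lp_one_add hb z.1
  have hg := FracHam.integrable_coe_Lp_one_add hb z.2
  have hA := FracHam.invFracLap_spec hs0 hN hb ho.measurableSet hf
  simp only [FracHam.IsL1WeakSolSystem, hU, hV, Prod.mk.eta,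
    FracHam.partialU_symm he, FracHam.partialV_symm he]
  refine ⟨FracHam.isL1WeakSol_of_integrableOn hs0 hN hb ho.measurableSet hg hui fun φ h hφ => ?_,
    FracHam.isL1WeakSol_of_integrableOn hs0 hN hb ho.measurableSet hf hvi fun φ h hφ => ?_⟩
  · exact FracHam.integral_partialU_mul_eq_of_isCriticalPoint hs0 hN hb ho hp hq hH' hgrowth hmono
      he hz hφ hint
  · rw [← hA.weak_eq φ h hφ]
    exact FracHam.integral_partialV_mul_eq_of_isCriticalPoint hs0 hN hb ho hp hq hH' hgrowth
      hmono he hz hφ.isTestFun hint
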